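/- Let $n\ge 1$ be an integer and let $V$ be a set of $n$ vertices. Put $m=\left\lfloor \frac{6(n-1)}{5}\right\rfloor+1$, and let $D_1,\dots,D_m$ be even cycles on $V$, that is, simple cycles of even length at least $4$ whose vertices lie in $V$; the cycles need not be distinct. Regard all edges of $D_i$ as having color $i$, so that an edge lying in several of the $D_i$ is available in several colors. Then the family contains a rainbow even cycle: there are an even cycle $R$ on $V$ and an injective map $\sigma\colon E(R)\to\{1,\dots,m\}$ such that $e\in E(D_{\sigma(e)})$ for every edge $e$ of $R$. -/

import Mathlib

/-- A simple graph regarded as a set of colored edges `(e, α)`: every `e` is a pair of two distinct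
vertices, and no pair of vertices occurs with two different colors. -/
structure ColoredGraph (V C : Type*) where
  /-- the set of colored edges -/
  edges : Set (Sym2 V × C)
  not_isDiag : ∀ e ∈ edges, ¬ e.1.IsDiag
  simple : ∀ e ∈ edges, ∀ f ∈ edges, e.1 = f.1 → e = f

namespace ColoredGraph

variable {V C : Type*}

/-- The set of uncolored edges. -/
def edgeSet (G : ColoredGraph V C) : Set (Sym2 V) := Prod.fst '' G.edges

/-- The set of colors that occur. -/
def colors (G : ColoredGraph V C) : Set C := Prod.snd '' G.edges

/-- The uncolored simple graph with the same edges. -/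
def toSimpleGraph (G : ColoredGraph V C) : SimpleGraph V := SimpleGraph.fromEdgeSet G.edgeSet

/-- `G` is a cycle of length `l`: its uncolored edges are exactly the edges of a cycle
`v₁ v₂ ⋯ v_l v₁` with `v₁, …, v_l` distinct and `l ≥ 3`. -/
def IsCycleOfLength (G : ColoredGraph V C) (l : ℕ) : Prop :=
  ∃ (u : V) (p : G.toSimpleGraph.Walk u u),
    p.IsCycle ∧ p.length = l ∧ ∀ e, e ∈ p.edges ↔ e ∈ G.edgeSet

/-- `G` is an even cycle. -/
def IsEvenCycle (G : ColoredGraph V C) : Prop := ∃ l, Even l ∧ G.IsCycleOfLength l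

/-- `G` is rainbow: distinct edges have distinct colors. -/
def IsRainbow (G : ColoredGraph V C) : Prop := Set.InjOn Prod.snd G.edges

/-- The graphs `D₁, …, D_m` form a family: each is monochromatic, and their colors are pairwise
different (while the underlying uncolored graphs may coincide). -/
def IsFamily {m : ℕ} (D : Fin m → ColoredGraph V C) : Prop :=
  ∃ α : Fin m → C, Function.Injective α ∧ ∀ i, (D i).colors = {α i}

/-- The family `D₁, …, D_m` contains `G`: every colored edge of `G` is an edge of some `D_i`. -/
def FamilyContains {m : ℕ} (D : Fin m → ColoredGraph V C) (G : ColoredGraph V C) : Prop :=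
  G.edges ⊆ ⋃ i, (D i).edges

end ColoredGraph

/-! Suppose no rainbow even cycle exists. Call a nonempty vertex set dense if it contains at least
as many of the cycles as it has vertices. The heart of the proof is to find a dense set, contract it
to a point and count. To allow iterated contraction, everything is done modulo a map `φ : V → X`
whose fibers are the points contracted so far.

Dense sets come from a matroid-style exchange argument (`exists_dense_of_exchange_closed`). Take a
largest rainbow forest modulo `φ` that omits some color, and exchange edges along fundamental
cycles. Each color that can be omitted has its cycle inside one component of the part of the forest
whose colors can be omitted. There are more such colors than edges in that part, so by counting some
component is dense.

Parity enters through a minimal dense set `W`. It has rainbow spanning trees, and the distance in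
such a tree between two given points of `W` can be changed from even to odd or back
(`MinimalDense.exists_isSpanning_switch`). Two consequences follow. First, `W` contains exactly
`|W|` cycles: an edge of a surplus cycle would close an even cycle with a suitable tree. Second,
after contracting `W`, a rainbow cycle of the quotient that does not close up in `V` can be
completed through `W` by a path of either parity, so it would yield a rainbow even cycle
(`Closing.collapse`).

Finally `|W| ≥ 6`, because four 4-cycles on four vertices, or five on five vertices, already have a
rainbow 4-cycle; this is a finite check. Each contraction thus removes `w` colors and `w - 1` points
with `w ≥ 6`, a ratio of at most `6/5`. Induction gives `5|A| + 6 ≤ 6|Q|`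
(`RainbowEvenFree.card_le`), which the assumed number of cycles violates. -/

/-! ### Connectivity modulo a map -/

/-- `p` and `q` are joined by a chain of images under `φ` of the edges in `N`. -/
def Linked {V X : Type*} (φ : V → X) (N : Set (Sym2 V)) (p q : X) : Prop :=
  ∀ c : X → Prop, (∀ u v, s(u, v) ∈ N → (c (φ u) ↔ c (φ v))) → (c p ↔ c q)

namespace Linked

variable {V X : Type*} {φ : V → X} {N M : Set (Sym2 V)} {p q r : X}

theorem refl (p : X) : Linked φ N p p := fun _ _ => Iff.rfl

theorem symm (h : Linked φ N p q) : Linked φ N q p := fun c hc => (h c hc).symm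

theorem trans (h : Linked φ N p q) (h' : Linked φ N q r) : Linked φ N p r :=
  fun c hc => (h c hc).trans (h' c hc)

theorem of_mem {u v : V} (h : s(u, v) ∈ N) : Linked φ N (φ u) (φ v) := fun _ hc => hc u v h

theorem mono (hNM : N ⊆ M) (h : Linked φ N p q) : Linked φ M p q :=
  fun c hc => h c fun u v huv => hc u v (hNM huv)

theorem of_forall (hNM : ∀ u v, s(u, v) ∈ N → Linked φ M (φ u) (φ v)) (h : Linked φ N p q) :
    Linked φ M p q :=
  fun c hc => h c fun u v huv => hNM u v huv c hc

theorem map {u v : V} (h : Linked id N u v) : Linked φ N (φ u) (φ v) :=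
  fun c hc => h (c ∘ φ) hc

/-- A path needs the new edge at most once, in one of its two directions. -/
theorem insert_cases {u v : V} (h : Linked φ (insert s(u, v) N) p q) :
    Linked φ N p q ∨ (Linked φ N p (φ u) ∧ Linked φ N (φ v) q) ∨
      (Linked φ N p (φ v) ∧ Linked φ N (φ u) q) := by
  have key := h (fun z => Linked φ N p z ∨ (Linked φ N p (φ u) ∧ Linked φ N (φ v) z) ∨
      (Linked φ N p (φ v) ∧ Linked φ N (φ u) z)) ?_
  · exact key.1 (Or.inl (refl p))
  · intro a b hab
    have step : ∀ a b : V, s(a, b) ∈ N →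
        (Linked φ N p (φ a) ∨ (Linked φ N p (φ u) ∧ Linked φ N (φ v) (φ a)) ∨
        (Linked φ N p (φ v) ∧ Linked φ N (φ u) (φ a))) →
        (Linked φ N p (φ b) ∨ (Linked φ N p (φ u) ∧ Linked φ N (φ v) (φ b)) ∨
        (Linked φ N p (φ v) ∧ Linked φ N (φ u) (φ b))) := by
      intro a b hab h
      have := of_mem (φ := φ) hab
      rcases h with h | ⟨h, h'⟩ | ⟨h, h'⟩
      · exact Or.inl (h.trans this)
      · exact Or.inr (Or.inl ⟨h, h'.trans this⟩)
      · exact Or.inr (Or.inr ⟨h, h'.trans this⟩)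
    rcases hab with hab | hab
    · have key : (Linked φ N p (φ u) ∨ (Linked φ N p (φ u) ∧ Linked φ N (φ v) (φ u)) ∨
        (Linked φ N p (φ v) ∧ Linked φ N (φ u) (φ u))) ↔
        (Linked φ N p (φ v) ∨ (Linked φ N p (φ u) ∧ Linked φ N (φ v) (φ v)) ∨
        (Linked φ N p (φ v) ∧ Linked φ N (φ u) (φ v))) := by
        have h1 := refl (φ := φ) (N := N) (φ u)
        have h2 := refl (φ := φ) (N := N) (φ v)
        tauto
      rcases Sym2.eq_iff.1 hab with ⟨rfl, rfl⟩ | ⟨rfl, rfl⟩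
      · exact key
      · exact key.symm
    · exact ⟨step a b hab, step b a (by rwa [Sym2.eq_swap])⟩

theorem mem_of_mem {W : Set V} {x y : V} (h : Linked id N x y)
    (hN : ∀ e ∈ N, ∀ v ∈ e, v ∈ W) (hx : x ∈ W) : y ∈ W :=
  (h (· ∈ W) fun u v huv => ⟨fun _ => hN _ huv v (Sym2.mem_mk_right u v),
    fun _ => hN _ huv u (Sym2.mem_mk_left u v)⟩).1 hx

theorem eq_of_forall {Y : Type*} {c : X → Y} (h : Linked φ N p q)
    (hc : ∀ u v, s(u, v) ∈ N → c (φ u) = c (φ v)) : c p = c q :=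
  ((h (fun z => c p = c z) fun u v huv => by rw [hc u v huv]).1 rfl)

end Linked

/-! ### Forests modulo a map -/

open Classical in
/-- The edges chosen for the colors in `S` are independent modulo the fibers of `φ`:
no edge closes a cycle with the others. -/
def Indep {V X ι : Type*} (φ : V → X) (S : Finset ι) (g : ι → Sym2 V) : Prop :=
  ∀ i ∈ S, ∀ a b, g i = s(a, b) → ¬ Linked φ (g '' ↑(S.erase i)) (φ a) (φ b)

section Choice

open Classical

variable {V X ι : Type*} {φ : V → X} {S : Finset ι} {g : ι → Sym2 V}

theorem image_update_insert_erase {i j : ι} (hj : j ∉ S.erase i) (f : Sym2 V) :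
    Function.update g j f '' ↑(insert j (S.erase i)) = insert f (g '' ↑(S.erase i)) := by
  rw [Finset.coe_insert, Set.image_insert_eq, Function.update_self]
  congr 1
  apply Set.image_congr
  intro a ha
  exact Function.update_of_ne (by rintro rfl; exact hj ha) _ _

theorem image_update_insert {j : ι} (hj : j ∉ S) (f : Sym2 V) :
    Function.update g j f '' ↑(insert j S) = insert f (g '' ↑S) := by
  rw [Finset.coe_insert, Set.image_insert_eq, Function.update_self]
  congr 1
  apply Set.image_congr
  intro a ha
  exact Function.update_of_ne (by rintro rfl; exact hj ha) _ _

theorem image_eq_insert_erase {i : ι} (hi : i ∈ S) :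
    g '' (S : Set ι) = insert (g i) (g '' ↑(S.erase i)) := by
  rw [← Set.image_insert_eq, ← Finset.coe_insert, Finset.insert_erase hi]

theorem Indep.mono {S' : Finset ι} (h : Indep φ S g) (hS : S' ⊆ S) : Indep φ S' g :=
  fun i hi a b hab hl => h i (hS hi) a b hab
    (hl.mono (Set.image_mono (Finset.coe_subset.2 (Finset.erase_subset_erase i hS))))

theorem Indep.congr {g' : ι → Sym2 V} (h : Indep φ S g) (hg : ∀ i ∈ S, g i = g' i) :
    Indep φ S g' := by
  intro i hi a b hab
  rw [← Set.image_congr (f := g) (g := g')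
    (fun k hk => hg k (Finset.mem_of_mem_erase (Finset.mem_coe.1 hk)))]
  exact h i hi a b (by rw [hg i hi, hab])

/-- A cycle through an old edge `g i` that uses the new edge, with the new edge taken out, would be
a path between `u` and `v` among the old edges. -/
theorem Indep.insert {j : ι} {u v : V} (h : Indep φ S g) (hj : j ∉ S) (hg : g j = s(u, v))
    (hl : ¬ Linked φ (g '' ↑S) (φ u) (φ v)) : Indep φ (insert j S) g := by
  intro i hi a b hab hl'
  rcases Finset.mem_insert.1 hi with rfl | hi
  · rw [Finset.erase_insert hj] at hl'
    rw [hg] at hab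
    rcases Sym2.eq_iff.1 hab with ⟨rfl, rfl⟩ | ⟨rfl, rfl⟩
    · exact hl hl'
    · exact hl hl'.symm
  · have hij : j ≠ i := by rintro rfl; exact hj hi
    rw [Finset.erase_insert_of_ne hij, Finset.coe_insert, Set.image_insert_eq, hg] at hl'
    have hsub : g '' ↑(S.erase i) ⊆ g '' ↑S :=
      Set.image_mono (Finset.coe_subset.2 (Finset.erase_subset i S))
    have hi' : Linked φ (g '' ↑S) (φ a) (φ b) :=
      Linked.of_mem (hab ▸ Set.mem_image_of_mem g (Finset.mem_coe.2 hi))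
    rcases hl'.insert_cases with h1 | ⟨h1, h2⟩ | ⟨h1, h2⟩
    · exact h i hi a b hab h1
    · exact hl (((h1.mono hsub).symm.trans hi').trans (h2.mono hsub).symm)
    · exact hl (((h2.mono hsub).trans hi'.symm).trans (h1.mono hsub))

theorem Indep.update_insert {j : ι} {u v : V} (h : Indep φ S g) (hj : j ∉ S)
    (hl : ¬ Linked φ (g '' ↑S) (φ u) (φ v)) :
    Indep φ (Insert.insert j S) (Function.update g j s(u, v)) := by
  have hg : ∀ i ∈ S, g i = Function.update g j s(u, v) i := fun i hi =>
    (Function.update_of_ne (by rintro rfl; exact hj hi) _ _).symm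
  refine (h.congr hg).insert hj (Function.update_self ..) ?_
  rwa [← Set.image_congr (f := g) (fun k hk => hg k hk)]

/-- Class representatives for `Linked`, with the count of classes. -/
theorem exists_representatives (φ : V → X) (Q : Finset X) (S : Finset ι) (g : ι → Sym2 V) :
    ∃ r : X → X, (∀ p q, r p = r q ↔ Linked φ (g '' ↑S) p q) ∧
      Q.card ≤ (Q.image r).card + S.card ∧
      (Indep φ S g → (∀ i ∈ S, ∀ v ∈ g i, φ v ∈ Q) → (Q.image r).card + S.card ≤ Q.card) := by
  induction S using Finset.induction_on with
  | empty =>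
    refine ⟨id, fun p q => ⟨?_, ?_⟩, by simp, by simp⟩
    · rintro (rfl : p = q)
      exact Linked.refl _
    · intro h
      exact h.eq_of_forall (c := id) (by simp)
  | insert i S hi ih =>
    obtain ⟨r, hr, hcard, hindep⟩ := ih
    obtain ⟨a, b, hab⟩ : ∃ a b, g i = s(a, b) := by
      induction g i with | _ a b => exact ⟨a, b, rfl⟩
    have himg : g '' ↑(insert i S) = insert s(a, b) (g '' ↑S) := by
      rw [Finset.coe_insert, Set.image_insert_eq, hab]
    have hsub : g '' ↑S ⊆ g '' ↑(insert i S) := himg ▸ Set.subset_insert _ _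
    have hlab : Linked φ (g '' ↑(insert i S)) (φ a) (φ b) :=
      Linked.of_mem (himg ▸ Set.mem_insert _ _)
    -- The class of `φ b` is merged into that of `φ a`. At most one representative is lost, and
    -- exactly one when the new edge is independent of the others and its ends map into `Q`.
    refine ⟨fun p => if r p = r (φ b) then r (φ a) else r p, fun p q => ⟨?_, ?_⟩, ?_, ?_⟩
    · have key : ∀ p, Linked φ (g '' ↑(insert i S)) p
          (if r p = r (φ b) then φ a else p) := by
        intro p
        split_ifs with h
        · exact (((hr _ _).1 h).mono hsub).trans hlab.symm
        · exact Linked.refl _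
      intro h
      have h' : r (if r p = r (φ b) then φ a else p) = r (if r q = r (φ b) then φ a else q) := by
        simpa only [apply_ite r] using h
      exact ((key p).trans (((hr _ _).1 h').mono hsub)).trans (key q).symm
    · intro h
      rw [himg] at h
      rcases h.insert_cases with h | ⟨h, h'⟩ | ⟨h, h'⟩
      · simp only [(hr _ _).2 h]
      · have h1 := (hr _ _).2 h
        have h2 := (hr _ _).2 h'
        simp only [h1, ← h2]
        simp
      · have h1 := (hr _ _).2 h
        have h2 := (hr _ _).2 h'
        simp only [h1, ← h2]
        simp
    · have : Q.image r ⊆ insert (r (φ b))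
          (Q.image fun p => if r p = r (φ b) then r (φ a) else r p) := by
        intro z hz
        obtain ⟨p, hp, rfl⟩ := Finset.mem_image.1 hz
        by_cases h : r p = r (φ b)
        · simp [h]
        · refine Finset.mem_insert_of_mem (Finset.mem_image.2 ⟨p, hp, by simp [h]⟩)
      have := (Finset.card_le_card this).trans (Finset.card_insert_le _ _)
      rw [Finset.card_insert_of_notMem hi]
      omega
    · intro hI hQ
      have hI' := hI.mono (Finset.subset_insert i S)
      have hne : r (φ a) ≠ r (φ b) := by
        intro h
        refine hI i (Finset.mem_insert_self _ _) a b hab ?_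
        rw [Finset.erase_insert hi]
        exact (hr _ _).1 h
      have hQ' := hQ i (Finset.mem_insert_self _ _)
      rw [hab] at hQ'
      have hsub : (Q.image fun p => if r p = r (φ b) then r (φ a) else r p) ⊆
          (Q.image r).erase (r (φ b)) := by
        intro z hz
        obtain ⟨p, hp, rfl⟩ := Finset.mem_image.1 hz
        split_ifs with h
        · exact Finset.mem_erase.2 ⟨hne, Finset.mem_image_of_mem r
            (hQ' a (Sym2.mem_mk_left _ _))⟩
        · exact Finset.mem_erase.2 ⟨h, Finset.mem_image_of_mem r hp⟩
      have hb : r (φ b) ∈ Q.image r :=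
        Finset.mem_image_of_mem r (hQ' b (Sym2.mem_mk_right _ _))
      have h1 := Finset.card_le_card hsub
      rw [Finset.card_erase_of_mem hb] at h1
      have h2 := Finset.card_pos.2 ⟨_, hb⟩
      have h3 := hindep hI' fun k hk => hQ k (Finset.mem_insert_of_mem hk)
      rw [Finset.card_insert_of_notMem hi]
      omega

theorem Indep.card_lt {Q : Finset X} (h : Indep φ S g) (hQ : Q.Nonempty)
    (hg : ∀ i ∈ S, ∀ v ∈ g i, φ v ∈ Q) : S.card < Q.card := by
  obtain ⟨r, -, -, hr⟩ := exists_representatives φ Q S g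
  have := Finset.card_pos.2 (hQ.image r)
  have := hr h hg
  omega

/-- A set of colors that is minimal with respect to linking two points. -/
theorem exists_minimal_linking {p q : X} (h : Linked φ (g '' ↑S) p q) :
    ∃ I ⊆ S, Linked φ (g '' ↑I) p q ∧ Indep φ I g ∧ ∀ i ∈ I, ∀ a b, g i = s(a, b) →
      (Linked φ (g '' ↑(I.erase i)) p (φ a) ∧ Linked φ (g '' ↑(I.erase i)) q (φ b)) ∨
      (Linked φ (g '' ↑(I.erase i)) p (φ b) ∧ Linked φ (g '' ↑(I.erase i)) q (φ a)) := by
  obtain ⟨I, hI, hmin⟩ := Finset.exists_min_image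
    (S.powerset.filter fun I : Finset ι => Linked φ (g '' ↑I) p q) Finset.card
    ⟨S, by simpa using h⟩
  simp only [Finset.mem_filter, Finset.mem_powerset] at hI hmin
  have hmin' : ∀ i ∈ I, ¬ Linked φ (g '' ↑(I.erase i)) p q := fun i hi hl => by
    have := hmin (I.erase i) ⟨(Finset.erase_subset _ _).trans hI.1, hl⟩
    have := Finset.card_erase_lt_of_mem hi
    omega
  have hsplit : ∀ i ∈ I, ∀ a b, g i = s(a, b) →
      (Linked φ (g '' ↑(I.erase i)) p (φ a) ∧ Linked φ (g '' ↑(I.erase i)) q (φ b)) ∨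
      (Linked φ (g '' ↑(I.erase i)) p (φ b) ∧ Linked φ (g '' ↑(I.erase i)) q (φ a)) := by
    intro i hi a b hab
    have hl := hI.2
    rw [image_eq_insert_erase hi, hab] at hl
    rcases hl.insert_cases with h | ⟨h, h'⟩ | ⟨h, h'⟩
    · exact absurd h (hmin' i hi)
    · exact Or.inl ⟨h, h'.symm⟩
    · exact Or.inr ⟨h, h'.symm⟩
  refine ⟨I, hI.1, hI.2, fun i hi a b hab hl => hmin' i hi ?_, hsplit⟩
  rcases hsplit i hi a b hab with ⟨h, h'⟩ | ⟨h, h'⟩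
  · exact (h.trans hl).trans h'.symm
  · exact (h.trans hl.symm).trans h'.symm

end Choice

/-! ### Even cycles and their cuts -/

/-- `E` is the edge set of a cycle of even length at least `4`. -/
def IsEvenCycleSet {V : Type*} (E : Set (Sym2 V)) : Prop :=
  ∃ k, 2 ≤ k ∧ ∃ c : ZMod (2 * k) → V, Function.Injective c ∧
    E = Set.range fun i => s(c i, c (i + 1))

/-- A predicate on a cyclic group that is neither empty nor full changes both ways. -/
theorem ZMod.exists_not_of_exists {l : ℕ} [NeZero l] (b : ZMod l → Prop) {i j : ZMod l}
    (hi : b i) (hj : ¬ b j) : ∃ k, b k ∧ ¬ b (k + 1) := by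
  by_contra! h
  have : ∀ n : ℕ, b (i + n) := by
    intro n
    induction n with
    | zero => simpa using hi
    | succ n ih => simpa [add_assoc] using h _ ih
  exact hj (by simpa using this (j - i).val)

namespace IsEvenCycleSet

variable {V : Type*} {E : Set (Sym2 V)}

theorem not_isDiag (h : IsEvenCycleSet E) {u v : V} (huv : s(u, v) ∈ E) : u ≠ v := by
  obtain ⟨k, hk, c, hc, rfl⟩ := h
  obtain ⟨i, hi⟩ := huv
  rintro rfl
  have : Fact (1 < 2 * k) := ⟨by omega⟩
  have : c i = c (i + 1) := by
    rcases Sym2.eq_iff.1 hi with ⟨h1, h2⟩ | ⟨h1, h2⟩ <;> rw [h1, h2]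
  simpa using hc this

theorem nonempty (h : IsEvenCycleSet E) : ∃ u v, s(u, v) ∈ E := by
  obtain ⟨k, hk, c, hc, rfl⟩ := h
  exact ⟨_, _, 0, rfl⟩

/-- A cycle lies on one side of every separation of order at most one. -/
theorem inseparable (h : IsEvenCycleSet E) {S T : Set V} (hST : (S ∩ T).Subsingleton)
    (hE : ∀ u v, s(u, v) ∈ E → (u ∈ S ∧ v ∈ S) ∨ (u ∈ T ∧ v ∈ T)) :
    (∀ u v, s(u, v) ∈ E → u ∈ S ∧ v ∈ S) ∨ (∀ u v, s(u, v) ∈ E → u ∈ T ∧ v ∈ T) := by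
  obtain ⟨k, hk, c, hc, rfl⟩ := h
  have : NeZero (2 * k) := ⟨by omega⟩
  have hE' : ∀ i, (c i ∈ S ∧ c (i + 1) ∈ S) ∨ (c i ∈ T ∧ c (i + 1) ∈ T) :=
    fun i => hE _ _ ⟨i, rfl⟩
  by_cases hS : ∀ i, c i ∈ S ∧ c (i + 1) ∈ S
  · left
    rintro u v ⟨i, hi⟩
    rcases Sym2.eq_iff.1 hi with ⟨rfl, rfl⟩ | ⟨rfl, rfl⟩
    · exact hS i
    · exact (hS i).symm
  by_cases hT : ∀ i, c i ∈ T ∧ c (i + 1) ∈ T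
  · right
    rintro u v ⟨i, hi⟩
    rcases Sym2.eq_iff.1 hi with ⟨rfl, rfl⟩ | ⟨rfl, rfl⟩
    · exact hT i
    · exact (hT i).symm
  exfalso
  rw [not_forall] at hS hT
  obtain ⟨i, hi⟩ := hS
  obtain ⟨j, hj⟩ := hT
  have hj' := (hE' j).resolve_right hj
  -- Going around, the cycle enters `S` at vertex `m + 1` and leaves it at vertex `n + 1`. Both
  -- vertices lie in `S ∩ T`, so they coincide, although edge `m` is outside `S` and edge `n`
  -- inside.
  obtain ⟨m, hm, hm'⟩ := ZMod.exists_not_of_exists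
    (fun i => ¬ (c i ∈ S ∧ c (i + 1) ∈ S)) hi (not_not.2 hj')
  obtain ⟨n, hn, hn'⟩ := ZMod.exists_not_of_exists
    (fun i => c i ∈ S ∧ c (i + 1) ∈ S) hj' hi
  have h1 : c (m + 1) ∈ S ∩ T := ⟨(not_not.1 hm').1, ((hE' m).resolve_left hm).2⟩
  have h2 : c (n + 1) ∈ S ∩ T := ⟨hn.2, ((hE' (n + 1)).resolve_left hn').1⟩
  have : m = n := by simpa using hc (hST h1 h2)
  exact hm (this ▸ hn)

/-- No edge of a cycle is the only one across a cut. -/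
theorem exists_ne_crossing (h : IsEvenCycleSet E) {B : Set V} {u v : V} (huv : s(u, v) ∈ E)
    (hu : u ∈ B) (hv : v ∉ B) (e : Sym2 V) : ∃ u' v', s(u', v') ∈ E ∧ u' ∈ B ∧ v' ∉ B ∧
      s(u', v') ≠ e := by
  obtain ⟨k, hk, c, hc, rfl⟩ := h
  have : NeZero (2 * k) := ⟨by omega⟩
  obtain ⟨i, j, hi, hj⟩ : ∃ i j, c i ∈ B ∧ c j ∉ B := by
    obtain ⟨i, hi⟩ := huv
    rcases Sym2.eq_iff.1 hi with ⟨rfl, rfl⟩ | ⟨rfl, rfl⟩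
    · exact ⟨_, _, hu, hv⟩
    · exact ⟨_, _, hu, hv⟩
  obtain ⟨m, hm, hm'⟩ := ZMod.exists_not_of_exists (fun i => c i ∈ B) hi hj
  obtain ⟨n, hn, hn'⟩ := ZMod.exists_not_of_exists (fun i => c i ∉ B) hj (not_not.2 hi)
  by_cases he : s(c m, c (m + 1)) = e
  · refine ⟨c (n + 1), c n, ⟨n, Sym2.eq_swap⟩, not_not.1 hn', hn, ?_⟩
    rw [← he]
    intro h
    rcases Sym2.eq_iff.1 h with ⟨h1, h2⟩ | ⟨h1, h2⟩
    · have h1 := hc h1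
      have h2 := hc h2
      subst h2
      -- If the crossings out of and into `B` were the same edge, the cycle would have length 2.
      have h3 : ((2 : ℕ) : ZMod (2 * k)) = 0 := by
        have : m + 2 = m := by linear_combination h1
        simpa using this
      rw [ZMod.natCast_eq_zero_iff] at h3
      have := Nat.le_of_dvd (by norm_num) h3
      omega
    · exact hm' (h1 ▸ not_not.1 hn')
  · exact ⟨c m, c (m + 1), ⟨m, rfl⟩, hm, hm', he⟩

/-- An even cycle is bipartite. -/
theorem exists_coloring (h : IsEvenCycleSet E) :
    ∃ χ : V → Prop, ∀ u v, s(u, v) ∈ E → ¬ (χ u ↔ χ v) := by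
  obtain ⟨k, hk, c, hc, rfl⟩ := h
  have : NeZero (2 * k) := ⟨by omega⟩
  let ρ : ZMod (2 * k) →+* ZMod 2 := ZMod.castHom (dvd_mul_right 2 k) (ZMod 2)
  have key : ∀ x : ZMod 2, ¬ (x = 0 ↔ x + 1 = 0) := by decide
  -- Color by the parity of the index along the cycle; the color off the cycle is irrelevant.
  refine ⟨fun v => ρ (Function.invFun c v) = 0, ?_⟩
  rintro u v ⟨i, hi⟩
  have h1 : ∀ i, Function.invFun c (c i) = i := Function.leftInverse_invFun hc
  rcases Sym2.eq_iff.1 hi with ⟨rfl, rfl⟩ | ⟨rfl, rfl⟩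
  · simpa [h1] using key (ρ i)
  · rw [Iff.comm]
    simpa [h1] using key (ρ i)

/-- If the vertices of `T` have distinct values under `c` and every edge of the cycle lies in `T`
or in a fiber of `c`, then the cycle lies in `T` unless it lies in a fiber. -/
theorem subset_of_fibers (h : IsEvenCycleSet E) {Y : Type*} {c : V → Y} {T : Set V}
    (hc : Set.InjOn c T) (hE : ∀ u v, s(u, v) ∈ E → c u = c v ∨ (u ∈ T ∧ v ∈ T)) {u₀ v₀ : V}
    (h₀ : s(u₀, v₀) ∈ E) (hne : c u₀ ≠ c v₀) : ∀ u v, s(u, v) ∈ E → u ∈ T ∧ v ∈ T := by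
  have hT₀ := (hE u₀ v₀ h₀).resolve_left hne
  have hside : ∀ t ∈ T, ∀ u v, s(u, v) ∈ E → (u = t ∨ c u ≠ c t) ∧ (v = t ∨ c v ≠ c t) := by
    intro t ht
    -- The fiber through `t` is attached to the rest only at `t`. The cycle is not contained in the
    -- fiber, because of the edge `u₀v₀`.
    refine (h.inseparable (S := {v | v = t ∨ c v ≠ c t}) (T := {v | c v = c t}) ?_ ?_).resolve_right
      ?_
    · have : ({v | v = t ∨ c v ≠ c t} ∩ {v | c v = c t} : Set V) ⊆ {t} := by
        rintro v ⟨hv | hv, hv'⟩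
        · exact hv
        · exact absurd hv' hv
      exact Set.subsingleton_singleton.anti this
    · intro u v huv
      rcases hE u v huv with h1 | ⟨h1, h2⟩
      · by_cases h2 : c u = c t
        · exact Or.inr ⟨h2, h1.symm.trans h2⟩
        · exact Or.inl ⟨Or.inr h2, Or.inr fun h3 => h2 (h1.trans h3)⟩
      · refine Or.inl ⟨?_, ?_⟩
        · exact or_iff_not_imp_right.2 fun h3 => hc h1 ht (not_not.1 h3)
        · exact or_iff_not_imp_right.2 fun h3 => hc h2 ht (not_not.1 h3)
    · intro hall
      obtain ⟨h1, h2⟩ := hall u₀ v₀ h₀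
      exact hne (h1.trans (h2 : c v₀ = c t).symm)
  refine (h.inseparable (S := T) (T := {v | v ∉ T ∧ ∀ t ∈ T, c v ≠ c t}) ?_ ?_).resolve_right ?_
  · rintro x ⟨hx, hx', -⟩
    exact absurd hx hx'
  · have hout : ∀ u v, s(u, v) ∈ E → u ∉ T → ∀ t ∈ T, c u ≠ c t := fun u v huv hu t ht =>
      (hside t ht u v huv).1.resolve_left (by rintro rfl; exact hu ht)
    intro u v huv
    have hvu : s(v, u) ∈ E := by rwa [Sym2.eq_swap]
    rcases hE u v huv with h1 | h1
    · by_cases hu : u ∈ T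
      · by_cases hv : v ∈ T
        · exact Or.inl ⟨hu, hv⟩
        · exact absurd h1.symm (hout v u hvu hv u hu)
      · by_cases hv : v ∈ T
        · exact absurd h1 (hout u v huv hu v hv)
        · exact Or.inr ⟨⟨hu, hout u v huv hu⟩, ⟨hv, hout v u hvu hv⟩⟩
    · exact Or.inl h1
  · intro hall
    exact (hall u₀ v₀ h₀).1.1 hT₀.1

end IsEvenCycleSet

/-! ### The exchange argument -/

section Exchange

open Classical

variable {V X ι : Type*} {D : ι → Set (Sym2 V)}

/-- `g` chooses an edge of color `j` for every `j ∈ S`, all colors being in `A`. -/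
def Choice (D : ι → Set (Sym2 V)) (A S : Finset ι) (g : ι → Sym2 V) : Prop :=
  S ⊆ A ∧ ∀ j ∈ S, g j ∈ D j

/-- The colors of `A` all of whose edges lie in `W`. -/
noncomputable def insideColors (D : ι → Set (Sym2 V)) (A : Finset ι) (W : Finset V) : Finset ι :=
  A.filter fun j => ∀ e ∈ D j, ∀ v ∈ e, v ∈ W

theorem mem_insideColors {A : Finset ι} {W : Finset V} {j : ι} :
    j ∈ insideColors D A W ↔ j ∈ A ∧ ∀ e ∈ D j, ∀ v ∈ e, v ∈ W := Finset.mem_filter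

theorem Choice.exchange {A S : Finset ι} {g : ι → Sym2 V} (h : Choice D A S g) {i j : ι}
    (hj : j ∈ A) {f : Sym2 V} (hf : f ∈ D j) :
    Choice D A (insert j (S.erase i)) (Function.update g j f) := by
  refine ⟨Finset.insert_subset hj ((Finset.erase_subset _ _).trans h.1), fun k hk => ?_⟩
  by_cases hkj : k = j
  · subst hkj
    simpa using hf
  · rw [Function.update_of_ne hkj]
    exact h.2 k (Finset.mem_of_mem_erase (Finset.mem_of_mem_insert_of_ne hk hkj))

theorem Choice.insert {A S : Finset ι} {g : ι → Sym2 V} (h : Choice D A S g) {j : ι}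
    (hj : j ∈ A) {f : Sym2 V} (hf : f ∈ D j) :
    Choice D A (insert j S) (Function.update g j f) := by
  refine ⟨Finset.insert_subset hj h.1, fun k hk => ?_⟩
  by_cases hkj : k = j
  · subst hkj
    simpa using hf
  · rw [Function.update_of_ne hkj]
    exact h.2 k (Finset.mem_of_mem_insert_of_ne hk hkj)

/-- A class of choices closed under exchanges along linking sets, one of which omits a color,
yields a nonempty vertex set `W` containing at least `|W|` of the graphs whose colors can be
omitted; moreover `W` is linked by edges whose colors can be omitted. -/
theorem exists_dense_of_exchange_closed [Fintype V] {A : Finset ι}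
    (hD : ∀ j ∈ A, IsEvenCycleSet (D j)) (F : Set (Finset ι × (ι → Sym2 V)))
    (hlink : ∀ s ∈ F, ∀ j ∈ A, j ∉ s.1 → ∀ u v, s(u, v) ∈ D j → Linked id (s.2 '' ↑s.1) u v)
    (hclosed : ∀ s ∈ F, ∀ j ∈ A, j ∉ s.1 → ∀ u v, s(u, v) ∈ D j →
      ∀ i ∈ s.1, ∀ a b, s.2 i = s(a, b) → Linked id (s.2 '' ↑(s.1.erase i)) u a →
      Linked id (s.2 '' ↑(s.1.erase i)) v b →
      (insert j (s.1.erase i), Function.update s.2 j s(u, v)) ∈ F)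
    {s₀ : Finset ι × (ι → Sym2 V)} (hs₀ : s₀ ∈ F) (hA : ∀ s ∈ F, s.1 ⊆ A) {j₀ : ι} (hj₀ : j₀ ∈ A)
    (hj₀' : j₀ ∉ s₀.1) :
    ∃ W : Finset V, W.Nonempty ∧ W.card ≤ (insideColors D A W).card ∧
      ∀ x ∈ W, ∀ y ∈ W, Linked id (s₀.2 '' {i | i ∈ s₀.1 ∧ ∃ s ∈ F, i ∉ s.1}) x y := by
  -- A step adds an edge `uv` of an unused color and deletes an edge of a path `I` that already
  -- joined `u` to `v`.
  let step : Finset ι × (ι → Sym2 V) → Finset ι × (ι → Sym2 V) → Prop := fun s t =>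
    ∃ j ∈ A, j ∉ s.1 ∧ ∃ u v, s(u, v) ∈ D j ∧ ∃ I ⊆ s.1, Linked id (s.2 '' ↑I) u v ∧
      (∀ i ∈ I, ∀ a b, s.2 i = s(a, b) →
        (Linked id (s.2 '' ↑(I.erase i)) u a ∧ Linked id (s.2 '' ↑(I.erase i)) v b) ∨
        (Linked id (s.2 '' ↑(I.erase i)) u b ∧ Linked id (s.2 '' ↑(I.erase i)) v a)) ∧
      ∃ i ∈ I, t = (insert j (s.1.erase i), Function.update s.2 j s(u, v))
  have hF : ∀ s, Relation.ReflTransGen step s₀ s → s ∈ F := by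
    intro s hs
    induction hs with
    | refl => exact hs₀
    | @tail s t _ hst ih =>
      obtain ⟨j, hj, hjs, u, v, huv, I, hI, -, hsplit, i, hi, rfl⟩ := hst
      obtain ⟨a, b, hab⟩ : ∃ a b, s.2 i = s(a, b) := by
        induction s.2 i with | _ a b => exact ⟨a, b, rfl⟩
      have hsub : s.2 '' ↑(I.erase i) ⊆ s.2 '' ↑(s.1.erase i) :=
        Set.image_mono (Finset.coe_subset.2 (Finset.erase_subset_erase i hI))
      rcases hsplit i hi a b hab with ⟨h1, h2⟩ | ⟨h1, h2⟩
      · exact hclosed s ih j hj hjs u v huv i (hI hi) a b hab (h1.mono hsub) (h2.mono hsub)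
      · exact hclosed s ih j hj hjs u v huv i (hI hi) b a (hab.trans Sym2.eq_swap)
          (h1.mono hsub) (h2.mono hsub)
  let J : Finset ι := A.filter fun j => ∃ s, Relation.ReflTransGen step s₀ s ∧ j ∉ s.1
  have hlinkJ : ∀ s, Relation.ReflTransGen step s₀ s → ∀ j ∈ A, j ∉ s.1 → ∀ u v, s(u, v) ∈ D j →
      ∀ I ⊆ s.1, Linked id (s.2 '' ↑I) u v →
      (∀ i ∈ I, ∀ a b, s.2 i = s(a, b) →
        (Linked id (s.2 '' ↑(I.erase i)) u a ∧ Linked id (s.2 '' ↑(I.erase i)) v b) ∨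
        (Linked id (s.2 '' ↑(I.erase i)) u b ∧ Linked id (s.2 '' ↑(I.erase i)) v a)) →
      I ⊆ J := by
    intro s hs j hj hjs u v huv I hI hl hsplit i hi
    refine Finset.mem_filter.2 ⟨hA s (hF s hs) (hI hi), _, hs.tail
      ⟨j, hj, hjs, u, v, huv, I, hI, hl, hsplit, i, hi, rfl⟩, ?_⟩
    have hij : i ≠ j := by rintro rfl; exact hjs (hI hi)
    simp [hij]
  -- All colors of the path `I` can be omitted after one further step, so `I ⊆ J`. The exchange
  -- therefore takes place within the edges colored by `J` and leaves their components unchanged.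
  have hinv : ∀ s, Relation.ReflTransGen step s₀ s → ∀ x y,
      Linked id (s.2 '' ↑(s.1 ∩ J)) x y ↔ Linked id (s₀.2 '' ↑(s₀.1 ∩ J)) x y := by
    intro s hs
    induction hs with
    | refl => exact fun _ _ => Iff.rfl
    | @tail s t hs hst ih =>
      obtain ⟨j, hj, hjs, u, v, huv, I, hI, hl, hsplit, i, hi, rfl⟩ := hst
      have hIJ := hlinkJ s hs j hj hjs u v huv I hI hl hsplit
      have hIs : I ⊆ s.1 ∩ J := Finset.subset_inter hI hIJ
      intro x y
      rw [← ih]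
      have hjJ : j ∈ J := Finset.mem_filter.2 ⟨hj, s, hs, hjs⟩
      have himg : Function.update s.2 j s(u, v) '' ↑(insert j (s.1.erase i) ∩ J) =
          insert s(u, v) (s.2 '' ↑((s.1 ∩ J).erase i)) := by
        rw [Finset.insert_inter_of_mem hjJ, Finset.erase_inter]
        exact image_update_insert_erase (fun h => hjs (Finset.mem_of_mem_inter_left
          (Finset.mem_of_mem_erase h))) _
      simp only [himg]
      have hsub : s.2 '' ↑((s.1 ∩ J).erase i) ⊆ s.2 '' ↑(s.1 ∩ J) :=
        Set.image_mono (Finset.coe_subset.2 (Finset.erase_subset i _))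
      constructor
      · refine Linked.of_forall fun p q hpq => ?_
        rcases hpq with hpq | hpq
        · have := hl.mono (Set.image_mono (Finset.coe_subset.2 hIs))
          rcases Sym2.eq_iff.1 hpq with ⟨rfl, rfl⟩ | ⟨rfl, rfl⟩
          · exact this
          · exact this.symm
        · exact Linked.of_mem (hsub hpq)
      · refine Linked.of_forall fun p q hpq => ?_
        rw [image_eq_insert_erase (hIs hi)] at hpq
        rcases hpq with hpq | hpq
        · have hsub' : s.2 '' ↑(I.erase i) ⊆ insert s(u, v) (s.2 '' ↑((s.1 ∩ J).erase i)) :=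
            (Set.image_mono (Finset.coe_subset.2 (Finset.erase_subset_erase i hIs))).trans
              (Set.subset_insert _ _)
          have huv' : Linked id (insert s(u, v) (s.2 '' ↑((s.1 ∩ J).erase i))) u v :=
            Linked.of_mem (φ := id) (Set.mem_insert _ _)
          rcases hsplit i hi p q hpq.symm with ⟨h1, h2⟩ | ⟨h1, h2⟩
          · exact ((h1.mono hsub').symm.trans huv').trans (h2.mono hsub')
          · exact ((h2.mono hsub').symm.trans huv'.symm).trans (h1.mono hsub')
        · exact Linked.of_mem (Set.mem_insert_of_mem _ hpq)
  obtain ⟨r, hr, hcard, -⟩ := exists_representatives id Finset.univ (s₀.1 ∩ J) s₀.2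
  have hedge : ∀ j ∈ J, ∀ u v, s(u, v) ∈ D j → r u = r v := by
    intro j hj u v huv
    obtain ⟨hjA, s, hs, hjs⟩ := Finset.mem_filter.1 hj
    obtain ⟨I, hI, hl, -, hsplit⟩ :=
      exists_minimal_linking (hlink s (hF s hs) j hjA hjs u v huv)
    have hIJ := hlinkJ s hs j hjA hjs u v huv I hI hl hsplit
    exact (hr u v).2 ((hinv s hs u v).1
      (hl.mono (Set.image_mono (Finset.coe_subset.2 (Finset.subset_inter hI hIJ)))))
  have hclass : ∀ j ∈ J, ∃ q ∈ Finset.univ.image r, ∀ e ∈ D j, ∀ v ∈ e, r v = q := by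
    intro j hj
    have hcyc := hD j (Finset.mem_filter.1 hj).1
    obtain ⟨u, v, huv⟩ := hcyc.nonempty
    refine ⟨r u, Finset.mem_image_of_mem r (Finset.mem_univ u), ?_⟩
    have := (hcyc.inseparable (S := {z | r z = r u}) (T := {z | r z ≠ r u}) ?_ ?_).resolve_right ?_
    · intro e he z hz
      induction e with | _ a b =>
      rcases Sym2.mem_iff.1 hz with rfl | rfl
      · exact (this _ _ he).1
      · exact (this _ _ he).2
    · rintro x ⟨hx, hx'⟩
      exact absurd hx hx'
    · intro a b hab
      by_cases h : r a = r u
      · exact Or.inl ⟨h, (hedge j hj a b hab).symm.trans h⟩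
      · exact Or.inr ⟨h, fun h' => h ((hedge j hj a b hab).trans h')⟩
    · intro h
      exact (h u v huv).1 rfl
  have : Nonempty V := ⟨(hD j₀ hj₀).nonempty.choose⟩
  choose! κ hκ hκ' using hclass
  have hj₀J : j₀ ∈ J := Finset.mem_filter.2 ⟨hj₀, s₀, .refl, hj₀'⟩
  have hlt : (s₀.1 ∩ J).card < J.card := by
    refine Finset.card_lt_card ⟨Finset.inter_subset_right, fun h => hj₀' ?_⟩
    exact Finset.mem_of_mem_inter_left (h hj₀J)
  -- Otherwise every class has more vertices than cycles, so the number of classes is at most `|V| -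
  -- |J|`; but `|s₀ ∩ J| < |J|` edges leave more classes than that.
  obtain ⟨q, hq, hWcard⟩ : ∃ q ∈ Finset.univ.image r,
      (Finset.univ.filter fun v => r v = q).card ≤ (J.filter fun j => κ j = q).card := by
    by_contra! hcon
    have h1 : (Finset.univ : Finset V).card =
        ∑ q ∈ Finset.univ.image r, (Finset.univ.filter fun v => r v = q).card :=
      Finset.card_eq_sum_card_fiberwise fun v _ => Finset.mem_image_of_mem r (Finset.mem_univ v)
    have h2 : J.card = ∑ q ∈ Finset.univ.image r, (J.filter fun j => κ j = q).card :=
      Finset.card_eq_sum_card_fiberwise fun j hj => hκ j hj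
    have h3 : ∑ q ∈ Finset.univ.image r, ((J.filter fun j => κ j = q).card + 1) ≤
        ∑ q ∈ Finset.univ.image r, (Finset.univ.filter fun v => r v = q).card :=
      Finset.sum_le_sum hcon
    rw [Finset.sum_add_distrib, ← h1, ← h2, Finset.sum_const, smul_eq_mul, mul_one] at h3
    omega
  refine ⟨Finset.univ.filter fun v => r v = q, ?_, hWcard.trans (Finset.card_le_card ?_), ?_⟩
  · obtain ⟨v, -, hv⟩ := Finset.mem_image.1 hq
    exact ⟨v, by simpa using hv⟩
  · intro j hj
    obtain ⟨hjJ, hjq⟩ := Finset.mem_filter.1 hj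
    refine mem_insideColors.2 ⟨(Finset.mem_filter.1 hjJ).1, fun e he v hv => ?_⟩
    simpa [hjq] using hκ' j hjJ e he v hv
  · intro x hx y hy
    have hxy : r x = r y :=
      (Finset.mem_filter.1 hx).2.trans (Finset.mem_filter.1 hy).2.symm
    refine ((hr x y).1 hxy).mono (Set.image_mono ?_)
    intro i hi
    obtain ⟨hi, hiJ⟩ := Finset.mem_inter.1 (Finset.mem_coe.1 hi)
    obtain ⟨-, s, hs, his⟩ := Finset.mem_filter.1 hiJ
    exact ⟨hi, s, hF s hs, his⟩

end Exchange

/-! ### Parity in the absence of rainbow even cycles -/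

/-- No partial transversal of the edge sets `D j`, `j ∈ A`, contains an even cycle. -/
def RainbowEvenFree {V ι : Type*} (D : ι → Set (Sym2 V)) (A : Finset ι) : Prop :=
  ∀ S g, Choice D A S g → ∀ (x : V) (p : (SimpleGraph.fromEdgeSet (g '' ↑S)).Walk x x),
    p.IsCycle → ¬ Even p.length

/-- `χ` is a proper two-coloring of the edges in `N`. -/
def Bicolors {V : Type*} (χ : V → Prop) (N : Set (Sym2 V)) : Prop :=
  ∀ u v, s(u, v) ∈ N → ¬ (χ u ↔ χ v)

section Coloring

open Classical

variable {V X ι : Type*} {D : ι → Set (Sym2 V)} {N M : Set (Sym2 V)} {χ χ' : V → Prop}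

theorem Bicolors.mono (h : Bicolors χ M) (hNM : N ⊆ M) : Bicolors χ N :=
  fun u v huv => h u v (hNM huv)

/-- Both sides express that paths in `N` from `x` to `y` have even length. Hence parity can be
compared between different trees sharing a path. -/
theorem Bicolors.congr_iff (h : Bicolors χ N) (h' : Bicolors χ' N) {x y : V}
    (hxy : Linked id N x y) : (χ x ↔ χ y) ↔ (χ' x ↔ χ' y) := by
  have := hxy (fun z => χ z ↔ χ' z) fun u v huv => by
    have h1 := h u v huv
    have h2 := h' u v huv
    simp only [id]
    tauto
  tauto

/-- Adding an edge between a union of classes and its complement keeps bipartiteness; the colors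
are switched on one side if necessary. -/
theorem Bicolors.switch (h : Bicolors χ N) {B : Set V} {u v : V}
    (hB : ∀ a b, s(a, b) ∈ N → (a ∈ B ↔ b ∈ B)) (hu : u ∈ B) (hv : v ∉ B) (huv : χ u ↔ χ v) :
    Bicolors (fun z => χ z ↔ z ∈ B) (insert s(u, v) N) := by
  intro a b hab
  rcases hab with hab | hab
  · rcases Sym2.eq_iff.1 hab with ⟨rfl, rfl⟩ | ⟨rfl, rfl⟩ <;> tauto
  · have := h a b hab
    have := hB a b hab
    tauto

theorem Indep.exists_bicolors {S : Finset ι} {g : ι → Sym2 V} (h : Indep id S g) :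
    ∃ χ, Bicolors χ (g '' ↑S) := by
  induction S using Finset.induction_on with
  | empty => exact ⟨fun _ => True, fun u v huv => by simp at huv⟩
  | insert i S hi ih =>
    obtain ⟨χ, hχ⟩ := ih (h.mono (Finset.subset_insert i S))
    obtain ⟨a, b, hab⟩ : ∃ a b, g i = s(a, b) := by
      induction g i with | _ a b => exact ⟨a, b, rfl⟩
    have hl := h i (Finset.mem_insert_self _ _) a b hab
    rw [Finset.erase_insert hi] at hl
    rw [Finset.coe_insert, Set.image_insert_eq, hab]
    by_cases hχab : χ a ↔ χ b
    · refine ⟨_, hχ.switch (B := {z | Linked id (g '' ↑S) a z}) ?_ (Linked.refl _) hl hχab⟩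
      intro p q hpq
      have := Linked.of_mem (φ := id) hpq
      exact ⟨fun h => h.trans this, fun h => h.trans this.symm⟩
    · refine ⟨χ, ?_⟩
      rintro p q (hpq | hpq)
      · rcases Sym2.eq_iff.1 hpq with ⟨rfl, rfl⟩ | ⟨rfl, rfl⟩ <;> tauto
      · exact hχ p q hpq

theorem Linked.reachable {x y : V} (h : Linked id N x y) :
    (SimpleGraph.fromEdgeSet N).Reachable x y := by
  refine (h (fun z => (SimpleGraph.fromEdgeSet N).Reachable x z) fun u v huv => ?_).1 (.refl x)
  by_cases huv' : u = v
  · subst huv'; exact Iff.rfl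
  · have hadj : (SimpleGraph.fromEdgeSet N).Adj u v :=
      (SimpleGraph.fromEdgeSet_adj N).2 ⟨huv, huv'⟩
    exact ⟨fun h => h.trans hadj.reachable, fun h => h.trans hadj.symm.reachable⟩

/-- In the absence of rainbow even cycles, an edge of an unused color joining two linked vertices
joins vertices of the same color class. -/
theorem RainbowEvenFree.congr_of_linked {A S : Finset ι} {g : ι → Sym2 V}
    (h : RainbowEvenFree D A) (hg : Choice D A S g) {j : ι} (hj : j ∈ A) (hjS : j ∉ S) {u v : V}
    (huv : s(u, v) ∈ D j) (hN : s(u, v) ∉ g '' ↑S) (hl : Linked id (g '' ↑S) u v)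
    (hχ : Bicolors χ (g '' ↑S)) : χ u ↔ χ v := by
  by_contra hne
  have huv' : u ≠ v := by rintro rfl; exact hne Iff.rfl
  obtain ⟨p, hp⟩ := hl.symm.reachable.exists_isPath
  have himg := image_update_insert hjS (g := g) s(u, v)
  have hle : SimpleGraph.fromEdgeSet (g '' ↑S) ≤
      SimpleGraph.fromEdgeSet (Function.update g j s(u, v) '' ↑(insert j S)) := by
    rw [himg]
    exact SimpleGraph.fromEdgeSet_mono (Set.subset_insert _ _)
  have hadj : (SimpleGraph.fromEdgeSet
      (Function.update g j s(u, v) '' ↑(insert j S))).Adj u v := by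
    rw [himg]
    exact (SimpleGraph.fromEdgeSet_adj _).2 ⟨Set.mem_insert _ _, huv'⟩
  have hcyc : (SimpleGraph.Walk.cons hadj (p.mapLe hle)).IsCycle := by
    rw [SimpleGraph.Walk.cons_isCycle_iff]
    refine ⟨(SimpleGraph.Walk.isPath_mapLe hle).2 hp, ?_⟩
    rw [SimpleGraph.Walk.edges_mapLe_eq_edges]
    intro hmem
    have := p.edges_subset_edgeSet hmem
    rw [SimpleGraph.edgeSet_fromEdgeSet] at this
    exact hN this.1
  refine h _ _ (hg.insert hj huv) _ _ hcyc ?_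
  let c : (SimpleGraph.fromEdgeSet (g '' ↑S)).Coloring Bool :=
    SimpleGraph.Coloring.mk (fun v => decide (χ v)) fun {a b} hab => by
      have := hχ a b ((SimpleGraph.fromEdgeSet_adj _).1 hab).1
      simpa using this
  have hc := c.odd_length_iff_not_congr p
  have hodd : Odd p.length := hc.2 (by
    change ¬ decide (χ v) = true ↔ decide (χ u) = true
    simp only [decide_eq_true_eq]
    tauto)
  simpa using hodd.add_one

end Coloring

/-! ### Dense sets from maximum forests -/

section DenseSets

open Classical

variable {V X ι : Type*} {D : ι → Set (Sym2 V)}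

/-- `|A| ≥ |Q|` even cycles that are nonconstant modulo `φ : V → Q` and have no rainbow cycle
modulo `φ` that fails to close up in `V` include `|W|` cycles inside a set `W` linked by a rainbow
forest. -/
theorem exists_dense_set [Fintype V] {φ : V → X} {A : Finset ι} {Q : Finset X} (hQ : Q.Nonempty)
    (hφQ : ∀ j ∈ A, ∀ e ∈ D j, ∀ v ∈ e, φ v ∈ Q) (hcard : Q.card ≤ A.card)
    (hD : ∀ j ∈ A, IsEvenCycleSet (D j))
    (hne : ∀ j ∈ A, ∃ u v, s(u, v) ∈ D j ∧ φ u ≠ φ v)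
    (hφ : ∀ S g, Choice D A S g → ∀ j ∈ A, j ∉ S → ∀ u v, s(u, v) ∈ D j → φ u ≠ φ v →
      Linked φ (g '' ↑S) (φ u) (φ v) → Linked id (g '' ↑S) u v) :
    ∃ S g, ∃ W : Finset V, Choice D A S g ∧ Indep φ S g ∧ W.Nonempty ∧
      W.card ≤ (insideColors D A W).card ∧ ∀ x ∈ W, ∀ y ∈ W, Linked id (g '' ↑S) x y := by
  obtain ⟨j₁, hj₁⟩ : A.Nonempty := Finset.card_pos.1 (hQ.card_pos.trans_le hcard)
  obtain ⟨S, hS, hmax⟩ := Finset.exists_max_image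
    (A.powerset.filter fun S : Finset ι => ∃ g, Choice D A S g ∧ Indep φ S g) Finset.card
    ⟨∅, by
      obtain ⟨u, v, -⟩ := hne j₁ hj₁
      simp only [Finset.mem_filter, Finset.empty_mem_powerset, true_and]
      exact ⟨fun _ => s(u, v), ⟨by simp, by simp⟩, fun i hi => by simp at hi⟩⟩
  obtain ⟨-, g, hSg, hSI⟩ := Finset.mem_filter.1 hS
  have hmax' : ∀ S' g', Choice D A S' g' → Indep φ S' g' → S'.card ≤ S.card := fun S' g' h h' =>
    hmax S' (Finset.mem_filter.2 ⟨Finset.mem_powerset.2 h.1, g', h, h'⟩)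
  let F : Set (Finset ι × (ι → Sym2 V)) :=
    {s | Choice D A s.1 s.2 ∧ Indep φ s.1 s.2 ∧ s.1.card = S.card}
  have hlt : S.card < A.card :=
    (hSI.card_lt hQ fun i hi => hφQ i (hSg.1 hi) _ (hSg.2 i hi)).trans_le hcard
  obtain ⟨j₀, hj₀, hj₀'⟩ := Finset.exists_mem_notMem_of_card_lt_card hlt
  have hlink : ∀ s ∈ F, ∀ j ∈ A, j ∉ s.1 → ∀ u v, s(u, v) ∈ D j →
      Linked id (s.2 '' ↑s.1) u v := by
    rintro ⟨S', g'⟩ ⟨hC, hI, hcd⟩ j hj hjS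
    dsimp only at hC hI hcd hjS ⊢
    have hedge : ∀ u v, s(u, v) ∈ D j → φ u ≠ φ v → Linked id (g' '' ↑S') u v := by
      intro u v huv huv'
      refine hφ S' g' hC j hj hjS u v huv huv' ?_
      by_contra hl
      have := hmax' _ _ (hC.insert hj huv) (hI.update_insert hjS hl)
      rw [Finset.card_insert_of_notMem hjS] at this
      omega
    obtain ⟨u₀, v₀, huv₀, hne₀⟩ := hne j hj
    -- The maximality of the forest controls only edges that are nonconstant modulo `φ`. For the
    -- others, the cycle is confined to the component `T` of one nonconstant edge. The map `c`
    -- contracts the forest edges outside `T`, in addition to the fibers of `φ`.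
    let T : Set V := {z | Linked id (g' '' ↑S') u₀ z}
    let O : Finset ι := S'.filter fun i => ∀ v ∈ g' i, v ∉ T
    have hOS : g' '' ↑O ⊆ g' '' ↑S' :=
      Set.image_mono (Finset.coe_subset.2 (Finset.filter_subset _ _))
    let c : V → Set X := fun z => {q | Linked φ (g' '' ↑O) (φ z) q}
    have hc_of : ∀ u v, Linked φ (g' '' ↑O) (φ u) (φ v) → c u = c v := fun u v h =>
      Set.ext fun q => ⟨fun h' => h.symm.trans h', fun h' => h.trans h'⟩
    have hc_to : ∀ u v, c u = c v → Linked φ (g' '' ↑O) (φ u) (φ v) := fun u v h => by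
      have : φ v ∈ c v := Linked.refl _
      rwa [← h] at this
    -- Two points of `T` with equal `c` would be joined both through `O` and by a path in `T`, which
    -- together close a cycle modulo `φ`.
    have hinj : Set.InjOn c T := by
      intro t ht t' ht' htt'
      by_contra hne'
      obtain ⟨I, hIS, hlI, -, hsplit⟩ :=
        exists_minimal_linking ((Linked.symm ht).trans ht' : Linked id (g' '' ↑S') t t')
      obtain ⟨i, hi⟩ : I.Nonempty := by
        rw [Finset.nonempty_iff_ne_empty]
        rintro rfl
        exact hne' (hlI.eq_of_forall (c := id) (by simp))
      obtain ⟨a, b, hab⟩ : ∃ a b, g' i = s(a, b) := by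
        induction g' i with | _ a b => exact ⟨a, b, rfl⟩
      have hsub : g' '' ↑(I.erase i) ⊆ g' '' ↑(S'.erase i) :=
        Set.image_mono (Finset.coe_subset.2 (Finset.erase_subset_erase i hIS))
      have hsub' : g' '' ↑(S'.erase i) ⊆ g' '' ↑S' :=
        Set.image_mono (Finset.coe_subset.2 (Finset.erase_subset i S'))
      have hOi : ∀ z, t ∈ T → Linked id (g' '' ↑(I.erase i)) t z → z ∈ g' i →
          g' '' ↑O ⊆ g' '' ↑(S'.erase i) := by
        intro z ht hz hzi
        refine Set.image_mono (Finset.coe_subset.2 fun k hk => ?_)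
        obtain ⟨hk, hkT⟩ := Finset.mem_filter.1 hk
        refine Finset.mem_erase.2 ⟨?_, hk⟩
        rintro rfl
        exact hkT z hzi (Linked.trans ht (hz.mono (hsub.trans hsub')))
      have hl := hc_to t t' htt'
      rcases hsplit i hi a b hab with ⟨h1, h2⟩ | ⟨h1, h2⟩
      · have hl' := hl.mono (hOi a ht h1 (by simp [hab]))
        exact hI i (hIS hi) a b hab
          (((h1.mono hsub).symm.map.trans hl').trans (h2.mono hsub).map)
      · have hl' := hl.mono (hOi b ht h1 (by simp [hab]))
        exact hI i (hIS hi) a b hab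
          (((h2.mono hsub).symm.map.trans hl'.symm).trans (h1.mono hsub).map)
    have hcover : ∀ u v, s(u, v) ∈ D j → c u = c v ∨ (u ∈ T ∧ v ∈ T) := by
      intro u v huv
      by_cases hφuv : φ u = φ v
      · left
        simp only [c, hφuv]
      have hl := hedge u v huv hφuv
      by_cases hu : u ∈ T
      · exact Or.inr ⟨hu, Linked.trans hu hl⟩
      · refine Or.inl (hc_of u v (Linked.map ?_))
        refine (hl (fun z => Linked id (g' '' ↑O) u z) fun a b hab => ?_).1 (Linked.refl _)
        obtain ⟨i, hi, hiab⟩ := hab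
        by_cases hiO : i ∈ O
        · have : Linked id (g' '' ↑O) a b := Linked.of_mem (φ := id) ⟨i, hiO, hiab⟩
          exact ⟨fun h => h.trans this, fun h => h.trans this.symm⟩
        · have habl : Linked id (g' '' ↑S') a b := Linked.of_mem (φ := id) ⟨i, hi, hiab⟩
          have haT : a ∈ T := by
            have : ¬ ∀ v ∈ g' i, v ∉ T := fun h => hiO (Finset.mem_filter.2 ⟨hi, h⟩)
            push Not at this
            obtain ⟨z, hz, hzT⟩ := this
            rw [hiab] at hz
            rcases Sym2.mem_iff.1 hz with rfl | rfl
            · exact hzT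
            · exact Linked.trans hzT habl.symm
          have hbT : b ∈ T := Linked.trans haT habl
          have hno : ∀ z ∈ T, ¬ Linked id (g' '' ↑O) u z := fun z hz h =>
            hu (Linked.trans hz (h.mono hOS).symm)
          exact ⟨fun h => absurd h (hno a haT), fun h => absurd h (hno b hbT)⟩
    have hc₀ : c u₀ ≠ c v₀ := by
      intro h
      have := hinj (Linked.refl _) (hedge u₀ v₀ huv₀ hne₀) h
      exact hne₀ (this ▸ rfl)
    intro u v huv
    have := (hD j hj).subset_of_fibers hinj hcover huv₀ hc₀ u v huv
    exact Linked.trans (Linked.symm this.1) this.2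
  have hclosed : ∀ s ∈ F, ∀ j ∈ A, j ∉ s.1 → ∀ u v, s(u, v) ∈ D j →
      ∀ i ∈ s.1, ∀ a b, s.2 i = s(a, b) → Linked id (s.2 '' ↑(s.1.erase i)) u a →
      Linked id (s.2 '' ↑(s.1.erase i)) v b →
      (insert j (s.1.erase i), Function.update s.2 j s(u, v)) ∈ F := by
    rintro ⟨S', g'⟩ ⟨hC, hI, hcd⟩ j hj hjS u v huv i hi a b hab hua hvb
    dsimp only at hC hI hcd hjS hi hab hua hvb ⊢
    have hjS' : j ∉ S'.erase i := fun h => hjS (Finset.mem_of_mem_erase h)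
    refine ⟨hC.exchange hj huv, (hI.mono (Finset.erase_subset i S')).update_insert hjS' ?_, ?_⟩
    · intro hl
      exact hI i hi a b hab ((hua.symm.map.trans hl).trans hvb.map)
    · dsimp only
      rw [Finset.card_insert_of_notMem hjS', Finset.card_erase_of_mem hi, hcd]
      have := Finset.card_pos.2 ⟨i, hi⟩
      omega
  obtain ⟨W, hW, hWcard, hWlink⟩ := exists_dense_of_exchange_closed hD F hlink hclosed
    (s₀ := (S, g)) ⟨hSg, hSI, rfl⟩ (fun s hs => hs.1.1) hj₀ hj₀'
  refine ⟨S, g, W, hSg, hSI, hW, hWcard, fun x hx y hy => ?_⟩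
  exact (hWlink x hx y hy).mono (Set.image_mono fun i hi => hi.1)

end DenseSets

/-! ### Minimal dense sets and parity switching -/

theorem iff_switch {p q a b : Prop} (h : ¬ (a ↔ b)) : ((p ↔ a) ↔ (q ↔ b)) ↔ ¬ (p ↔ q) := by
  by_cases a <;> by_cases b <;> by_cases p <;> by_cases q <;> simp_all

section MinimalDense

open Classical

variable {V ι : Type*} {D : ι → Set (Sym2 V)} {A R S : Finset ι} {W : Finset V}
  {g : ι → Sym2 V} {χ : V → Prop}

/-- `W` is a minimal nonempty set containing at least `|W|` of the graphs. -/
def MinimalDense (D : ι → Set (Sym2 V)) (A : Finset ι) (W : Finset V) : Prop :=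
  W.Nonempty ∧ W.card ≤ (insideColors D A W).card ∧
    ∀ W' ⊂ W, W'.Nonempty → (insideColors D A W').card < W'.card

theorem exists_minimalDense {W₀ : Finset V} (h : W₀.Nonempty)
    (h' : W₀.card ≤ (insideColors D A W₀).card) : ∃ W ⊆ W₀, MinimalDense D A W := by
  obtain ⟨W, hW, hmin⟩ := Finset.exists_min_image
    (W₀.powerset.filter fun W => W.Nonempty ∧ W.card ≤ (insideColors D A W).card) Finset.card
    ⟨W₀, by simp [h, h']⟩
  simp only [Finset.mem_filter, Finset.mem_powerset] at hW hmin
  refine ⟨W, hW.1, hW.2.1, hW.2.2, fun W' hW' hne => ?_⟩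
  by_contra hcon
  have h1 := hmin W' ⟨hW'.1.trans hW.1, hne, not_lt.1 hcon⟩
  have h2 := Finset.card_lt_card hW'
  omega

/-- A rainbow tree spanning `W`. -/
def IsSpanning (D : ι → Set (Sym2 V)) (R : Finset ι) (W : Finset V) (S : Finset ι)
    (g : ι → Sym2 V) : Prop :=
  Choice D R S g ∧ Indep id S g ∧ ∀ x ∈ W, ∀ y ∈ W, Linked id (g '' ↑S) x y

theorem Choice.mem_of_inside (hS : Choice D R S g) (hR : R ⊆ insideColors D A W) :
    ∀ e ∈ g '' ↑S, ∀ v ∈ e, v ∈ W := by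
  rintro _ ⟨i, hi, rfl⟩
  exact (mem_insideColors.1 (hR (hS.1 hi))).2 _ (hS.2 i hi)

theorem IsSpanning.card_lt (h : IsSpanning D R W S g) (hR : R ⊆ insideColors D A W)
    (hW : W.Nonempty) : S.card < W.card :=
  h.2.1.card_lt hW fun _ hi => h.1.mem_of_inside hR _ (Set.mem_image_of_mem g hi)

/-- A dense set linked by edges inside a minimal dense set `W` is all of `W`. -/
theorem MinimalDense.eq_of_linked (hW : MinimalDense D A W)
    (hD : ∀ j ∈ A, IsEvenCycleSet (D j)) (hR : R ⊆ insideColors D A W) (hS : Choice D R S g)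
    {W' : Finset V} (hne : W'.Nonempty) (hcard : W'.card ≤ (insideColors D R W').card)
    (hl : ∀ x ∈ W', ∀ y ∈ W', Linked id (g '' ↑S) x y) : W' = W := by
  obtain ⟨j, hj⟩ := Finset.card_pos.1 (hne.card_pos.trans_le hcard)
  obtain ⟨hjR, hj⟩ := mem_insideColors.1 hj
  obtain ⟨hjA, hjW⟩ := mem_insideColors.1 (hR hjR)
  obtain ⟨u, v, huv⟩ := (hD j hjA).nonempty
  have hu := Sym2.mem_mk_left u v
  have hsub : W' ⊆ W := fun z hz =>
    (hl u (hj _ huv u hu) z hz).mem_of_mem (W := (W : Set V)) (hS.mem_of_inside hR)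
      (hjW _ huv u hu)
  by_contra hWW
  have h1 := hW.2.2 W' (hsub.ssubset_of_ne hWW) hne
  have h2 : insideColors D R W' ⊆ insideColors D A W' :=
    Finset.filter_subset_filter _ fun k hk => (mem_insideColors.1 (hR hk)).1
  have := Finset.card_le_card h2
  omega

/-- For `φ = id` the forest construction yields a linked dense set, which minimality forces to be
all of `W`. -/
theorem MinimalDense.exists_isSpanning [Fintype V] (hW : MinimalDense D A W)
    (hD : ∀ j ∈ A, IsEvenCycleSet (D j)) (hR : R ⊆ insideColors D A W) (hcard : W.card ≤ R.card) :
    ∃ S g, IsSpanning D R W S g := by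
  have hDR : ∀ j ∈ R, IsEvenCycleSet (D j) := fun j hj => hD j (mem_insideColors.1 (hR hj)).1
  obtain ⟨S, g, W', hS, hI, hne, hW', hl⟩ := exists_dense_set (φ := id) hW.1
    (fun j hj => (mem_insideColors.1 (hR hj)).2) hcard hDR
    (fun j hj => by
      obtain ⟨u, v, huv⟩ := (hDR j hj).nonempty
      exact ⟨u, v, huv, (hDR j hj).not_isDiag huv⟩)
    (fun S g _ j _ _ u v _ _ h => h)
  obtain rfl := hW.eq_of_linked hD hR hS hne hW' hl
  exact ⟨S, g, hS, hI, hl⟩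

theorem IsSpanning.exchange (h : IsSpanning D R W S g) {j : ι} (hj : j ∈ R) (hjS : j ∉ S)
    {u v : V} (huv : s(u, v) ∈ D j) {i : ι} (hi : i ∈ S) {a b : V} (hab : g i = s(a, b))
    (hua : Linked id (g '' ↑(S.erase i)) u a) (hvb : Linked id (g '' ↑(S.erase i)) v b) :
    IsSpanning D R W (insert j (S.erase i)) (Function.update g j s(u, v)) := by
  have hjS' : j ∉ S.erase i := fun h => hjS (Finset.mem_of_mem_erase h)
  refine ⟨h.1.exchange hj huv,
    (h.2.1.mono (Finset.erase_subset i S)).update_insert hjS' fun hl =>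
      h.2.1 i hi a b hab ((hua.symm.trans hl).trans hvb), fun x hx y hy => ?_⟩
  refine (h.2.2 x hx y hy).of_forall fun p q hpq => ?_
  rw [image_update_insert_erase hjS']
  rw [image_eq_insert_erase hi, hab] at hpq
  have hab' : Linked id (insert s(u, v) (g '' ↑(S.erase i))) a b := by
    have hsub := Set.subset_insert s(u, v) (g '' ↑(S.erase i))
    exact ((hua.mono hsub).symm.trans (Linked.of_mem (φ := id) (Set.mem_insert _ _))).trans
      (hvb.mono hsub)
  rcases hpq with hpq | hpq
  · rcases Sym2.eq_iff.1 hpq with ⟨rfl, rfl⟩ | ⟨rfl, rfl⟩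
    · exact hab'
    · exact hab'.symm
  · exact Linked.of_mem (Set.mem_insert_of_mem _ hpq)

/-- In a minimal dense set, the parity of the distance between two points in a rainbow spanning
tree can be changed; if it becomes odd, the two points are not adjacent in the new tree. -/
theorem MinimalDense.exists_isSpanning_switch [Fintype V] (hW : MinimalDense D A W)
    (hD : ∀ j ∈ A, IsEvenCycleSet (D j)) (hfree : RainbowEvenFree D R)
    (hR : R ⊆ insideColors D A W) (hcard : W.card ≤ R.card) (hS : IsSpanning D R W S g)
    (hχ : Bicolors χ (g '' ↑S)) {x y : V} (hx : x ∈ W) (hy : y ∈ W) (hxy : x ≠ y) :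
    ∃ S' g' χ', IsSpanning D R W S' g' ∧ Bicolors χ' (g' '' ↑S') ∧
      ((χ' x ↔ χ' y) ↔ ¬ (χ x ↔ χ y)) ∧ ((χ x ↔ χ y) → s(x, y) ∉ g' '' ↑S') := by
  by_contra hcon
  have hno : ∀ S' g' χ', IsSpanning D R W S' g' → Bicolors χ' (g' '' ↑S') →
      ((χ' x ↔ χ' y) ↔ ¬ (χ x ↔ χ y)) → (χ x ↔ χ y) ∧ s(x, y) ∈ g' '' ↑S' := by
    intro S' g' χ' h₁ h₂ h₃
    by_contra h₄
    exact hcon ⟨S', g', χ', h₁, h₂, h₃, fun h₅ h₆ => h₄ ⟨h₅, h₆⟩⟩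
  have hDR : ∀ j ∈ R, IsEvenCycleSet (D j) := fun j hj => hD j (mem_insideColors.1 (hR hj)).1
  obtain ⟨P, hPS, hPl, -, hPsplit⟩ := exists_minimal_linking (hS.2.2 x hx y hy)
  -- The spanning trees that keep the path `P` from `x` to `y`. If no switch is possible, `F` turns
  -- out to be closed under exchanges.
  let F : Set (Finset ι × (ι → Sym2 V)) :=
    {s | IsSpanning D R W s.1 s.2 ∧ P ⊆ s.1 ∧ ∀ i ∈ P, s.2 i = g i}
  have himgP : ∀ s ∈ F, ∀ Q ⊆ P, s.2 '' (Q : Set ι) = g '' ↑Q := fun s hs Q hQ =>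
    Set.image_congr fun i hi => hs.2.2 i (hQ hi)
  have hin : ∀ j ∈ R, ∀ u v, s(u, v) ∈ D j → u ∈ W ∧ v ∈ W := fun j hj u v huv =>
    ⟨(mem_insideColors.1 (hR hj)).2 _ huv u (Sym2.mem_mk_left u v),
      (mem_insideColors.1 (hR hj)).2 _ huv v (Sym2.mem_mk_right u v)⟩
  -- Replacing `g i` by `uv` flips the parity between `x` and `y`: the ends of `uv` have equal
  -- colors, and the cut separates `x` from `y`. By `hno` the new tree contains `xy`, and `x`, `y`
  -- had equal colors before. So `xy` is not an old edge; it must be `uv`.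
  have hcross : ∀ s ∈ F, ∀ j ∈ R, j ∉ s.1 → ∀ i ∈ P, ∀ a b, s.2 i = s(a, b) →
      ∀ u v, s(u, v) ∈ D j → Linked id (s.2 '' ↑(s.1.erase i)) a u →
      ¬ Linked id (s.2 '' ↑(s.1.erase i)) a v → s(u, v) ≠ g i →
      s(u, v) = s(x, y) ∧ (χ x ↔ χ y) := by
    rintro ⟨S', g'⟩ hs j hj hjS i hi a b hab u v huv hau hav hne
    obtain ⟨hT, hPS', hPg⟩ := id hs
    dsimp only at hab hau hav hT hPS' hPg hjS
    have hjS' : j ∉ S'.erase i := fun h => hjS (Finset.mem_of_mem_erase h)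
    obtain ⟨χ₁, hχ₁⟩ := hT.2.1.exists_bicolors
    have hχ₁xy : (χ₁ x ↔ χ₁ y) ↔ (χ x ↔ χ y) := by
      have h1 : Bicolors χ₁ (g '' ↑P) := by
        rw [← himgP _ hs P subset_rfl]
        exact hχ₁.mono (Set.image_mono (Finset.coe_subset.2 hPS'))
      exact h1.congr_iff (hχ.mono (Set.image_mono (Finset.coe_subset.2 hPS))) hPl
    have hnotmem : s(u, v) ∉ g' '' ↑S' := by
      rintro ⟨k, hk, hkuv⟩
      have hki : k ≠ i := by
        rintro rfl
        exact hne (hkuv.symm.trans (hPg k hi))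
      exact hav (hau.trans (Linked.of_mem (φ := id)
        ⟨k, Finset.mem_coe.2 (Finset.mem_erase.2 ⟨hki, hk⟩), hkuv⟩))
    obtain ⟨huW, hvW⟩ := hin j hj u v huv
    have hχuv : χ₁ u ↔ χ₁ v :=
      hfree.congr_of_linked hT.1 hj hjS huv hnotmem (hT.2.2 u huW v hvW) hχ₁
    have hvb : Linked id (g' '' ↑(S'.erase i)) v b := by
      have h1 := hT.2.2 u huW v hvW
      rw [image_eq_insert_erase (hPS' hi), hab] at h1
      rcases h1.insert_cases with h1 | ⟨-, h1⟩ | ⟨h1, h2⟩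
      · exact absurd (hau.trans h1) hav
      · exact h1.symm
      · exact absurd h2 hav
    have hT' := hT.exchange hj hjS huv (hPS' hi) hab hau.symm hvb
    let B : Set V := {z | Linked id (g' '' ↑(S'.erase i)) a z}
    have hχ₂ : Bicolors (fun z => χ₁ z ↔ z ∈ B)
        (Function.update g' j s(u, v) '' ↑(insert j (S'.erase i))) := by
      rw [image_update_insert_erase hjS']
      refine (hχ₁.mono (Set.image_mono (Finset.coe_subset.2 (Finset.erase_subset i S')))).switch
        ?_ hau hav hχuv
      intro p q hpq
      have := Linked.of_mem (φ := id) hpq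
      exact ⟨fun h => Linked.trans h this, fun h => Linked.trans h this.symm⟩
    have hxyB : ¬ (x ∈ B ↔ y ∈ B) := by
      have hsub : g '' ↑(P.erase i) ⊆ g' '' ↑(S'.erase i) := by
        rw [← himgP _ hs (P.erase i) (Finset.erase_subset i P)]
        exact Set.image_mono (Finset.coe_subset.2 (Finset.erase_subset_erase i hPS'))
      have hab'' := hT.2.1 i (hPS' hi) a b hab
      rcases hPsplit i hi a b ((hPg i hi).symm.trans hab) with ⟨h1, h2⟩ | ⟨h1, h2⟩
      · have h3 : x ∈ B := (h1.mono hsub).symm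
        have h4 : y ∉ B := fun h => hab'' (Linked.trans h (h2.mono hsub))
        tauto
      · have h3 : y ∈ B := (h2.mono hsub).symm
        have h4 : x ∉ B := fun h => hab'' (Linked.trans h (h1.mono hsub))
        tauto
    obtain ⟨hpar, hmem⟩ := hno _ _ _ hT' hχ₂
      ((iff_switch hxyB).trans (not_congr hχ₁xy))
    rw [image_update_insert_erase hjS'] at hmem
    refine ⟨?_, hpar⟩
    rcases hmem with hmem | hmem
    · exact hmem.symm
    · refine absurd (hχ₁xy.2 hpar) (hχ₁ x y ?_)
      exact Set.image_mono (Finset.coe_subset.2 (Finset.erase_subset i S')) hmem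
  have hnotP : ∀ s ∈ F, ∀ j ∈ R, j ∉ s.1 → ∀ u v, s(u, v) ∈ D j → ∀ i ∈ s.1, ∀ a b,
      s.2 i = s(a, b) → Linked id (s.2 '' ↑(s.1.erase i)) u a →
      Linked id (s.2 '' ↑(s.1.erase i)) v b → i ∉ P := by
    intro s hs j hj hjS u v huv i hi a b hab hua hvb hiP
    have hsep := hs.1.2.1 i hi a b hab
    have hav : ¬ Linked id (s.2 '' ↑(s.1.erase i)) a v := fun h => hsep (h.trans hvb)
    obtain ⟨u', v', huv', hu', hv', hne⟩ := (hDR j hj).exists_ne_crossing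
      (B := {z | Linked id (s.2 '' ↑(s.1.erase i)) a z}) huv hua.symm hav (g i)
    obtain ⟨hxy', hpar⟩ := hcross s hs j hj hjS i hiP a b hab u' v' huv' hu' hv' hne
    rw [hxy'] at huv'
    obtain ⟨ψ, hψ⟩ := (hDR j hj).exists_coloring
    refine hψ x y huv' ?_
    -- The cycle contains `xy`, so it crosses each cut along `P` a second time. By `hcross` this can
    -- only be at `g k` itself. Thus it contains the even path `P` and the edge `xy`, which an even
    -- cycle cannot.
    have hall : ∀ k ∈ P, g k ∈ D j := by
      intro k hk
      obtain ⟨p, q, hpq⟩ : ∃ p q, s.2 k = s(p, q) := by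
        induction s.2 k with | _ p q => exact ⟨p, q, rfl⟩
      have hsep := hs.1.2.1 k (hs.2.1 hk) p q hpq
      have hsub : g '' ↑(P.erase k) ⊆ s.2 '' ↑(s.1.erase k) := by
        rw [← himgP _ hs (P.erase k) (Finset.erase_subset k P)]
        exact Set.image_mono (Finset.coe_subset.2 (Finset.erase_subset_erase k hs.2.1))
      have hfind : ∀ x' y', s(x', y') ∈ D j → s(x', y') = s(x, y) →
          Linked id (s.2 '' ↑(s.1.erase k)) p x' →
          ¬ Linked id (s.2 '' ↑(s.1.erase k)) p y' → g k ∈ D j := by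
        intro x' y' h1 h2 h3 h4
        obtain ⟨u₁, v₁, huv₁, hu₁, hv₁, hne₁⟩ := (hDR j hj).exists_ne_crossing
          (B := {z | Linked id (s.2 '' ↑(s.1.erase k)) p z}) h1 h3 h4 s(x, y)
        by_contra hgk
        have hne₂ : s(u₁, v₁) ≠ g k := fun h => hgk (h ▸ huv₁)
        exact hne₁ (hcross s hs j hj hjS k hk p q hpq u₁ v₁ huv₁ hu₁ hv₁ hne₂).1
      rcases hPsplit k hk p q ((hs.2.2 k hk).symm.trans hpq) with ⟨h1, h2⟩ | ⟨h1, h2⟩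
      · exact hfind x y huv' rfl (h1.mono hsub).symm fun h => hsep (h.trans (h2.mono hsub))
      · exact hfind y x (by rwa [Sym2.eq_swap]) Sym2.eq_swap (h2.mono hsub).symm
          fun h => hsep (h.trans (h1.mono hsub))
    have hψP : Bicolors ψ (g '' ↑P) := by
      rintro p q ⟨k, hk, hkpq⟩
      exact hψ p q (hkpq ▸ hall k hk)
    exact ((hχ.mono (Set.image_mono (Finset.coe_subset.2 hPS))).congr_iff hψP hPl).1 hpar
  have hlt := (hS.card_lt hR hW.1).trans_le hcard
  obtain ⟨j₀, hj₀, hj₀'⟩ := Finset.exists_mem_notMem_of_card_lt_card hlt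
  have hclosed : ∀ s ∈ F, ∀ j ∈ R, j ∉ s.1 → ∀ u v, s(u, v) ∈ D j →
      ∀ i ∈ s.1, ∀ a b, s.2 i = s(a, b) → Linked id (s.2 '' ↑(s.1.erase i)) u a →
      Linked id (s.2 '' ↑(s.1.erase i)) v b →
      (insert j (s.1.erase i), Function.update s.2 j s(u, v)) ∈ F := by
    intro s hs j hj hjS u v huv i hi a b hab hua hvb
    have hiP := hnotP s hs j hj hjS u v huv i hi a b hab hua hvb
    refine ⟨hs.1.exchange hj hjS huv hi hab hua hvb, fun k hk => ?_, fun k hk => ?_⟩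
    · refine Finset.mem_insert_of_mem (Finset.mem_erase.2 ⟨?_, hs.2.1 hk⟩)
      rintro rfl
      exact hiP hk
    · have hkj : k ≠ j := by
        rintro rfl
        exact hjS (hs.2.1 hk)
      exact (Function.update_of_ne hkj _ _).trans (hs.2.2 k hk)
  obtain ⟨W', hne, hW'card, hW'l⟩ := exists_dense_of_exchange_closed hDR F
    (fun s hs j hj _ u v huv => hs.1.2.2 u (hin j hj u v huv).1 v (hin j hj u v huv).2)
    hclosed (s₀ := (S, g)) ⟨hS, hPS, fun _ _ => rfl⟩ (fun s hs => hs.1.1.1) hj₀ hj₀'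
  -- The dense set obtained from `F` is `W`, linked by edges whose colors can be omitted. The colors
  -- of `P` never are, yet deleting an edge of `P` separates `x` from `y`.
  obtain rfl := hW.eq_of_linked hD hR hS.1 hne hW'card fun p hp q hq =>
    (hW'l p hp q hq).mono (Set.image_mono fun i hi => hi.1)
  obtain ⟨i, hi⟩ : P.Nonempty := by
    rw [Finset.nonempty_iff_ne_empty]
    rintro rfl
    exact hxy (hPl.eq_of_forall (c := id) (by simp))
  obtain ⟨a, b, hab⟩ : ∃ a b, g i = s(a, b) := by
    induction g i with | _ a b => exact ⟨a, b, rfl⟩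
  have hsep := hS.2.1 i (hPS hi) a b hab
  have hxy' : Linked id (g '' ↑(S.erase i)) x y := by
    refine (hW'l x hx y hy).mono (Set.image_mono ?_)
    rintro k ⟨hk, s, hs, hks⟩
    refine Finset.mem_coe.2 (Finset.mem_erase.2 ⟨?_, hk⟩)
    rintro rfl
    exact hks (hs.2.1 hi)
  have hsub : g '' ↑(P.erase i) ⊆ g '' ↑(S.erase i) :=
    Set.image_mono (Finset.coe_subset.2 (Finset.erase_subset_erase i hPS))
  rcases hPsplit i hi a b hab with ⟨h1, h2⟩ | ⟨h1, h2⟩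
  · exact hsep (((h1.mono hsub).symm.trans hxy').trans (h2.mono hsub))
  · exact hsep (((h2.mono hsub).symm.trans hxy'.symm).trans (h1.mono hsub))

theorem RainbowEvenFree.mono (h : RainbowEvenFree D A) (hR : R ⊆ A) : RainbowEvenFree D R :=
  fun S g hS => h S g ⟨hS.1.trans hR, hS.2⟩

/-- A minimal dense set is not over-full. -/
theorem MinimalDense.card_insideColors [Fintype V] (hW : MinimalDense D A W)
    (hD : ∀ j ∈ A, IsEvenCycleSet (D j)) (hfree : RainbowEvenFree D A) :
    (insideColors D A W).card = W.card := by
  by_contra hne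
  have hlt : W.card < (insideColors D A W).card := lt_of_le_of_ne hW.2.1 (Ne.symm hne)
  obtain ⟨j, hj⟩ := Finset.card_pos.1 ((Nat.zero_le _).trans_lt hlt)
  obtain ⟨hjA, hjW⟩ := mem_insideColors.1 hj
  set R := (insideColors D A W).erase j with hRdef
  have hR : R ⊆ insideColors D A W := Finset.erase_subset _ _
  have hRA : R ⊆ A := fun k hk => (mem_insideColors.1 (hR hk)).1
  have hcard : W.card ≤ R.card := by
    rw [hRdef, Finset.card_erase_of_mem hj]
    omega
  obtain ⟨x, y, hxy⟩ := (hD j hjA).nonempty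
  have hx := hjW _ hxy x (Sym2.mem_mk_left x y)
  have hy := hjW _ hxy y (Sym2.mem_mk_right x y)
  have hxyne := (hD j hjA).not_isDiag hxy
  -- Switching makes the distance odd with `xy` not in the tree; the edge `xy` in the spare color
  -- `j` would then close a rainbow even cycle.
  have hfin : ∀ S g χ, IsSpanning D R W S g → Bicolors χ (g '' ↑S) → (χ x ↔ χ y) → False := by
    intro S g χ hS hχ hpar
    obtain ⟨S', g', χ', hS', hχ', hpar', hmem⟩ :=
      hW.exists_isSpanning_switch hD (hfree.mono hRA) hR hcard hS hχ hx hy hxyne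
    have hjS' : j ∉ S' := fun h => Finset.notMem_erase j _ (hS'.1.1 h)
    have := hfree.congr_of_linked ⟨hS'.1.1.trans hRA, hS'.1.2⟩ hjA hjS' hxy (hmem hpar)
      (hS'.2.2 x hx y hy) hχ'
    tauto
  obtain ⟨S, g, hS⟩ := hW.exists_isSpanning hD hR hcard
  obtain ⟨χ, hχ⟩ := hS.2.1.exists_bicolors
  by_cases hpar : χ x ↔ χ y
  · exact hfin S g χ hS hχ hpar
  · obtain ⟨S', g', χ', hS', hχ', hpar', -⟩ :=
      hW.exists_isSpanning_switch hD (hfree.mono hRA) hR hcard hS hχ hx hy hxyne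
    exact hfin S' g' χ' hS' hχ' (hpar'.2 hpar)

end MinimalDense

/-! ### Finite check on at most five vertices -/

/-- The 4-cycle `a b c d` on vertices below `5`, as a bit mask of its oriented edges. -/
def cycleMask (a b c d : ℕ) : ℕ :=
  2 ^ (5 * a + b) ||| 2 ^ (5 * b + a) ||| 2 ^ (5 * b + c) ||| 2 ^ (5 * c + b) |||
    2 ^ (5 * c + d) ||| 2 ^ (5 * d + c) ||| 2 ^ (5 * d + a) ||| 2 ^ (5 * a + d)

/-- The bit masks of the 4-cycles on `{0, 1, 2, 3}`. -/
def masksFour : List ℕ := [174250, 206118, 101772]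

/-- The bit masks of the 4-cycles on `{0, 1, 2, 3, 4}`. -/
def masksFive : List ℕ := masksFour ++ [5261490, 6309414, 3149460, 10027314, 11043370, 3244824,
  10101780, 13157388, 5431320, 11152000, 13191552, 6513408]

/-- The 4-cycles on `{0, 1, 2, 3, 4}`, the edge from `a` to `b` being encoded as `5 * a + b`. -/
def fourCycles : List (ℕ × ℕ × ℕ × ℕ) := [(1, 7, 13, 15), (1, 8, 17, 10), (2, 11, 8, 15),
  (1, 7, 14, 20), (1, 9, 22, 10), (2, 11, 9, 20), (1, 8, 19, 20), (1, 9, 23, 15), (3, 16, 9, 20),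
  (2, 13, 19, 20), (2, 14, 23, 15), (3, 17, 14, 20), (7, 13, 19, 21), (7, 14, 23, 16),
  (8, 17, 14, 21)]

/-- The bit `e` of the mask `m`. -/
def hasEdge (m e : ℕ) : Bool := Nat.ble (Nat.pow 2 e) (Nat.land m (Nat.pow 2 e))

/-- Two masks have distinct representatives for two edges. -/
def represent₂ (a b x y : ℕ) : Bool := (hasEdge a x && hasEdge b y) || (hasEdge b x && hasEdge a y)

/-- Three masks have distinct representatives for three edges. -/
def represent₃ (a b c x y z : ℕ) : Bool :=
  (hasEdge a x && represent₂ b c y z) || (hasEdge b x && represent₂ a c y z) ||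
    (hasEdge c x && represent₂ a b y z)

/-- Four masks have distinct representatives for four edges. -/
def represent₄ (a b c d x y z w : ℕ) : Bool :=
  (hasEdge a x && represent₃ b c d y z w) || (hasEdge b x && represent₃ a c d y z w) ||
    (hasEdge c x && represent₃ a b d y z w) || (hasEdge d x && represent₃ a b c y z w)

/-- Four masks have a rainbow 4-cycle. -/
def rainbow₄ (a b c d : ℕ) : Bool :=
  fourCycles.any fun z => represent₄ a b c d z.1 z.2.1 z.2.2.1 z.2.2.2

/-- Five masks have a rainbow 4-cycle. -/
def rainbow₅ (a b c d e : ℕ) : Bool :=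
  rainbow₄ a b c d || rainbow₄ a b c e || rainbow₄ a b d e || rainbow₄ a c d e || rainbow₄ b c d e

theorem all_rainbow₄ : (masksFour.all fun a => masksFour.all fun b => masksFour.all fun c =>
    rainbow₄ 174250 a b c) = true := by
  decide +kernel

/-- After relabeling, the first cycle is `0 1 2 3`, whose mask is `174250`. A fifth cycle is tried
only when the first four have no rainbow 4-cycle. -/
theorem all_rainbow₅ : (masksFive.all fun a => masksFive.all fun b => masksFive.all fun c =>
    rainbow₄ 174250 a b c || masksFive.all fun d => rainbow₅ 174250 a b c d) = true := by
  decide +kernel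

theorem cycleMask_mem_masksFour : ∀ a b c d : Fin 4, [a, b, c, d].Nodup →
    cycleMask a b c d ∈ masksFour := by
  decide +kernel

theorem cycleMask_mem_masksFive : ∀ a b c d : Fin 5, [a, b, c, d].Nodup →
    cycleMask a b c d ∈ masksFive := by
  decide +kernel

theorem exists_of_mem_fourCycles {z : ℕ × ℕ × ℕ × ℕ} (hz : z ∈ fourCycles) :
    ∃ a b c d, [a, b, c, d].Nodup ∧ (a < 5 ∧ b < 5 ∧ c < 5 ∧ d < 5) ∧
      z = (5 * a + b, 5 * b + c, 5 * c + d, 5 * d + a) := by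
  have h : ∀ z ∈ fourCycles, [z.1 / 5, z.2.1 / 5, z.2.2.1 / 5, z.2.2.2 / 5].Nodup ∧
      (z.1 / 5 < 5 ∧ z.2.1 / 5 < 5 ∧ z.2.2.1 / 5 < 5 ∧ z.2.2.2 / 5 < 5) ∧
      z = (5 * (z.1 / 5) + z.2.1 / 5, 5 * (z.2.1 / 5) + z.2.2.1 / 5,
        5 * (z.2.2.1 / 5) + z.2.2.2 / 5, 5 * (z.2.2.2 / 5) + z.1 / 5) := by
    decide +kernel
  exact ⟨_, _, _, _, h z hz⟩

theorem hasEdge_eq_testBit (m e : ℕ) : hasEdge m e = m.testBit e := by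
  have h : hasEdge m e = Nat.ble (2 ^ e) (m &&& 2 ^ e) := rfl
  rw [Bool.eq_iff_iff, h, Nat.ble_eq, Nat.and_two_pow]
  cases m.testBit e <;> simp

theorem testBit_cycleMask {a b c d x y : ℕ} (ha : a < 5) (hb : b < 5) (hc : c < 5) (hd : d < 5)
    (hy : y < 5) (h : hasEdge (cycleMask a b c d) (5 * x + y) = true) :
    (x = a ∧ y = b) ∨ (x = b ∧ y = a) ∨ (x = b ∧ y = c) ∨ (x = c ∧ y = b) ∨
      (x = c ∧ y = d) ∨ (x = d ∧ y = c) ∨ (x = d ∧ y = a) ∨ (x = a ∧ y = d) := by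
  have key : ∀ p q, q < 5 → 5 * p + q = 5 * x + y → x = p ∧ y = q := by omega
  rw [hasEdge_eq_testBit] at h
  simp only [cycleMask, Nat.testBit_or, Nat.testBit_two_pow, Bool.or_eq_true,
    decide_eq_true_eq, or_assoc] at h
  exact h.imp (key _ _ hb) <| Or.imp (key _ _ ha) <| Or.imp (key _ _ hc) <| Or.imp (key _ _ hb) <|
    Or.imp (key _ _ hd) <| Or.imp (key _ _ hc) <| Or.imp (key _ _ ha) (key _ _ hd)

section SmallSets

open Classical

variable {V ι : Type*} {D : ι → Set (Sym2 V)} {A : Finset ι}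

theorem exists_of_represent₂ {P : ι → ℕ → Prop} {i j : ι} {a b x y : ℕ} (hij : [i, j].Nodup)
    (ha : ∀ e, hasEdge a e = true → P i e) (hb : ∀ e, hasEdge b e = true → P j e)
    (h : represent₂ a b x y = true) :
    ∃ i' j', [i', j'].Nodup ∧ (∀ q ∈ [i', j'], q ∈ [i, j]) ∧ P i' x ∧ P j' y := by
  simp only [represent₂, Bool.or_eq_true, Bool.and_eq_true] at h
  rcases h with ⟨h1, h2⟩ | ⟨h1, h2⟩
  · exact ⟨i, j, hij, fun _ h => h, ha _ h1, hb _ h2⟩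
  · exact ⟨j, i, by grind, by grind, hb _ h1, ha _ h2⟩

theorem exists_of_represent₃ {P : ι → ℕ → Prop} {i j k : ι} {a b c x y z : ℕ}
    (hijk : [i, j, k].Nodup) (ha : ∀ e, hasEdge a e = true → P i e)
    (hb : ∀ e, hasEdge b e = true → P j e) (hc : ∀ e, hasEdge c e = true → P k e)
    (h : represent₃ a b c x y z = true) :
    ∃ i' j' k', [i', j', k'].Nodup ∧ (∀ q ∈ [i', j', k'], q ∈ [i, j, k]) ∧
      P i' x ∧ P j' y ∧ P k' z := by
  simp only [represent₃, Bool.or_eq_true, Bool.and_eq_true] at h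
  rcases h with (⟨h1, h2⟩ | ⟨h1, h2⟩) | ⟨h1, h2⟩
  · obtain ⟨j', k', hn, hs, h3⟩ := exists_of_represent₂ (by grind) hb hc h2
    exact ⟨i, j', k', by grind, by grind, ha _ h1, h3⟩
  · obtain ⟨j', k', hn, hs, h3⟩ := exists_of_represent₂ (by grind) ha hc h2
    exact ⟨j, j', k', by grind, by grind, hb _ h1, h3⟩
  · obtain ⟨j', k', hn, hs, h3⟩ := exists_of_represent₂ (by grind) ha hb h2
    exact ⟨k, j', k', by grind, by grind, hc _ h1, h3⟩

theorem exists_of_represent₄ {P : ι → ℕ → Prop} {i j k l : ι} {a b c d x y z w : ℕ}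
    (hijkl : [i, j, k, l].Nodup) (ha : ∀ e, hasEdge a e = true → P i e)
    (hb : ∀ e, hasEdge b e = true → P j e) (hc : ∀ e, hasEdge c e = true → P k e)
    (hd : ∀ e, hasEdge d e = true → P l e) (h : represent₄ a b c d x y z w = true) :
    ∃ i' j' k' l', [i', j', k', l'].Nodup ∧ (∀ q ∈ [i', j', k', l'], q ∈ [i, j, k, l]) ∧
      P i' x ∧ P j' y ∧ P k' z ∧ P l' w := by
  simp only [represent₄, Bool.or_eq_true, Bool.and_eq_true] at h
  rcases h with ((⟨h1, h2⟩ | ⟨h1, h2⟩) | ⟨h1, h2⟩) | ⟨h1, h2⟩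
  · obtain ⟨j', k', l', hn, hs, h3⟩ := exists_of_represent₃ (by grind) hb hc hd h2
    exact ⟨i, j', k', l', by grind, by grind, ha _ h1, h3⟩
  · obtain ⟨j', k', l', hn, hs, h3⟩ := exists_of_represent₃ (by grind) ha hc hd h2
    exact ⟨j, j', k', l', by grind, by grind, hb _ h1, h3⟩
  · obtain ⟨j', k', l', hn, hs, h3⟩ := exists_of_represent₃ (by grind) ha hb hd h2
    exact ⟨k, j', k', l', by grind, by grind, hc _ h1, h3⟩
  · obtain ⟨j', k', l', hn, hs, h3⟩ := exists_of_represent₃ (by grind) ha hb hc h2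
    exact ⟨l, j', k', l', by grind, by grind, hd _ h1, h3⟩

theorem RainbowEvenFree.not_fourCycle (hfree : RainbowEvenFree D A) {a b c d : V}
    (habcd : [a, b, c, d].Nodup) {j₁ j₂ j₃ j₄ : ι} (hj : [j₁, j₂, j₃, j₄].Nodup)
    (hA : ∀ j ∈ [j₁, j₂, j₃, j₄], j ∈ A) (h₁ : s(a, b) ∈ D j₁) (h₂ : s(b, c) ∈ D j₂)
    (h₃ : s(c, d) ∈ D j₃) (h₄ : s(d, a) ∈ D j₄) : False := by
  simp only [List.nodup_cons, List.mem_cons, List.not_mem_nil, or_false, not_or,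
    List.nodup_nil, not_false_eq_true, and_true] at habcd hj
  obtain ⟨⟨hab, hac, had⟩, ⟨hbc, hbd⟩, hcd⟩ := habcd
  obtain ⟨⟨h12, h13, h14⟩, ⟨h23, h24⟩, h34⟩ := hj
  let g : ι → Sym2 V := fun j => if j = j₁ then s(a, b) else if j = j₂ then s(b, c) else s(c, d)
  have g1 : g j₁ = s(a, b) := by simp [g]
  have g2 : g j₂ = s(b, c) := by simp [g, Ne.symm h12]
  have g3 : g j₃ = s(c, d) := by simp [g, Ne.symm h13, Ne.symm h23]
  have himg : g '' ↑({j₁, j₂, j₃} : Finset ι) = {s(a, b), s(b, c), s(c, d)} := by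
    simp [Set.image_insert_eq, g1, g2, g3]
  have hC : Choice D A {j₁, j₂, j₃} g := by
    constructor
    · intro j hj
      refine hA j ?_
      simp only [Finset.mem_insert, Finset.mem_singleton] at hj
      simp only [List.mem_cons]
      tauto
    · intro j hj
      simp only [Finset.mem_insert, Finset.mem_singleton] at hj
      rcases hj with rfl | rfl | rfl
      · rwa [g1]
      · rwa [g2]
      · rwa [g3]
  have hl : Linked id (g '' ↑({j₁, j₂, j₃} : Finset ι)) d a := by
    rw [himg]
    exact (((Linked.of_mem (φ := id) (u := a) (v := b) (by simp)).trans (Linked.of_mem (φ := id) (u := b)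
      (v := c) (by simp))).trans (Linked.of_mem (φ := id) (u := c) (v := d) (by simp)) :
      Linked id {s(a, b), s(b, c), s(c, d)} a d).symm
  -- The path `a b c d` is properly colored by `{a, c}` against the rest, and the closing edge `da`
  -- joins different colors.
  have key := hfree.congr_of_linked (χ := fun z => z = a ∨ z = c) hC (hA j₄ (by simp))
    (by simp [Ne.symm h14, Ne.symm h24, Ne.symm h34]) h₄
    (by
      rw [himg]
      simp only [Set.mem_insert_iff, Set.mem_singleton_iff, Sym2.eq_iff, not_or, not_and]
      grind) hl
    (by
      rw [himg]
      intro p q hpq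
      simp only [Set.mem_insert_iff, Set.mem_singleton_iff, Sym2.eq_iff] at hpq
      grind)
  grind

/-- The mask `m` describes edges of color `j` among the vertices `f 0, …, f (n - 1)`. -/
def Encodes (D : ι → Set (Sym2 V)) (f : ℕ → V) (n : ℕ) (j : ι) (m : ℕ) : Prop :=
  ∀ e, hasEdge m e = true → ∀ x < 5, ∀ y < 5, e = 5 * x + y → x < n ∧ y < n ∧ s(f x, f y) ∈ D j

theorem RainbowEvenFree.not_rainbow₄ (hfree : RainbowEvenFree D A) {f : ℕ → V} {n : ℕ}
    (hf : ∀ x < n, ∀ y < n, f x = f y → x = y) {i j k l : ι} (hijkl : [i, j, k, l].Nodup)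
    (hA : ∀ q ∈ [i, j, k, l], q ∈ A) {a b c d : ℕ} (ha : Encodes D f n i a)
    (hb : Encodes D f n j b) (hc : Encodes D f n k c) (hd : Encodes D f n l d) :
    rainbow₄ a b c d ≠ true := by
  intro h
  simp only [rainbow₄, List.any_eq_true] at h
  obtain ⟨z, hz, h⟩ := h
  obtain ⟨v₁, v₂, v₃, v₄, hv, ⟨h₁, h₂, h₃, h₄⟩, rfl⟩ := exists_of_mem_fourCycles hz
  obtain ⟨i', j', k', l', hn, hs, e₁, e₂, e₃, e₄⟩ := exists_of_represent₄
    (P := fun q e => ∀ x < 5, ∀ y < 5, e = 5 * x + y → x < n ∧ y < n ∧ s(f x, f y) ∈ D q)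
    hijkl ha hb hc hd h
  obtain ⟨n₁, n₂, e₁⟩ := e₁ v₁ h₁ v₂ h₂ rfl
  obtain ⟨-, n₃, e₂⟩ := e₂ v₂ h₂ v₃ h₃ rfl
  obtain ⟨-, n₄, e₃⟩ := e₃ v₃ h₃ v₄ h₄ rfl
  obtain ⟨-, -, e₄⟩ := e₄ v₄ h₄ v₁ h₁ rfl
  refine hfree.not_fourCycle (a := f v₁) (b := f v₂) (c := f v₃) (d := f v₄) ?_ hn
    (fun q hq => hA q (hs q hq)) e₁ e₂ e₃ e₄
  refine List.Nodup.map_on (l := [v₁, v₂, v₃, v₄]) (f := f) (fun x hx y hy hxy => ?_) hv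
  have hlt : ∀ x ∈ [v₁, v₂, v₃, v₄], x < n := by
    intro x hx
    simp only [List.mem_cons, List.not_mem_nil, or_false] at hx
    rcases hx with rfl | rfl | rfl | rfl <;> assumption
  exact hf x (hlt x hx) y (hlt y hy) hxy

theorem RainbowEvenFree.not_rainbow₅ (hfree : RainbowEvenFree D A) {f : ℕ → V} {n : ℕ}
    (hf : ∀ x < n, ∀ y < n, f x = f y → x = y) {i j k l q : ι} (hnd : [i, j, k, l, q].Nodup)
    (hA : ∀ p ∈ [i, j, k, l, q], p ∈ A) {a b c d e : ℕ} (ha : Encodes D f n i a)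
    (hb : Encodes D f n j b) (hc : Encodes D f n k c) (hd : Encodes D f n l d)
    (he : Encodes D f n q e) : rainbow₅ a b c d e ≠ true := by
  intro h
  have hsub : ∀ l' : List ι, l'.Sublist [i, j, k, l, q] → l'.Nodup ∧ ∀ p ∈ l', p ∈ A :=
    fun l' hl' => ⟨hnd.sublist hl', fun p hp => hA p (hl'.subset hp)⟩
  simp only [rainbow₅, Bool.or_eq_true] at h
  rcases h with (((h | h) | h) | h) | h
  · have := hsub [i, j, k, l] (((((List.Sublist.slnil.cons q).cons_cons l).cons_cons k).cons_cons j).cons_cons i)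
    exact hfree.not_rainbow₄ hf this.1 this.2 ha hb hc hd h
  · have := hsub [i, j, k, q] (((((List.Sublist.slnil.cons_cons q).cons l).cons_cons k).cons_cons j).cons_cons i)
    exact hfree.not_rainbow₄ hf this.1 this.2 ha hb hc he h
  · have := hsub [i, j, l, q] (((((List.Sublist.slnil.cons_cons q).cons_cons l).cons k).cons_cons j).cons_cons i)
    exact hfree.not_rainbow₄ hf this.1 this.2 ha hb hd he h
  · have := hsub [i, k, l, q] (((((List.Sublist.slnil.cons_cons q).cons_cons l).cons_cons k).cons j).cons_cons i)
    exact hfree.not_rainbow₄ hf this.1 this.2 ha hc hd he h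
  · have := hsub [j, k, l, q] (((((List.Sublist.slnil.cons_cons q).cons_cons l).cons_cons k).cons_cons j).cons i)
    exact hfree.not_rainbow₄ hf this.1 this.2 hb hc hd he h

/-- An even cycle on at most five vertices is a 4-cycle. -/
theorem IsEvenCycleSet.exists_fourCycle {E : Set (Sym2 V)} (h : IsEvenCycleSet E) {W : Finset V}
    (hE : ∀ e ∈ E, ∀ v ∈ e, v ∈ W) (hW : W.card ≤ 5) :
    ∃ a b c d, [a, b, c, d].Nodup ∧ (∀ v ∈ [a, b, c, d], v ∈ W) ∧
      E = {s(a, b), s(b, c), s(c, d), s(d, a)} := by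
  obtain ⟨k, hk, c, hc, rfl⟩ := h
  have : NeZero (2 * k) := ⟨by omega⟩
  have hcW : ∀ i, c i ∈ W := fun i => hE _ ⟨i, rfl⟩ _ (Sym2.mem_mk_left _ _)
  have hcard : 2 * k ≤ W.card := by
    rw [← ZMod.card (2 * k), ← Finset.card_univ]
    exact Finset.card_le_card_of_injOn c (fun i _ => hcW i) hc.injOn
  obtain rfl : k = 2 := by omega
  have huniv : ∀ i : ZMod (2 * 2), i = 0 ∨ i = 1 ∨ i = 2 ∨ i = 3 := by decide
  refine ⟨c 0, c 1, c 2, c 3, ?_, ?_, ?_⟩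
  · exact List.Nodup.map (l := [0, 1, 2, 3]) hc (by decide)
  · intro v hv
    simp only [List.mem_cons, List.not_mem_nil, or_false] at hv
    rcases hv with rfl | rfl | rfl | rfl <;> exact hcW _
  · have h1 : (1 : ZMod (2 * 2)) + 1 = 2 := by decide
    have h2 : (2 : ZMod (2 * 2)) + 1 = 3 := by decide
    have h3 : (3 : ZMod (2 * 2)) + 1 = 0 := by decide
    ext e
    simp only [Set.mem_range, Set.mem_insert_iff, Set.mem_singleton_iff]
    constructor
    · rintro ⟨i, rfl⟩
      rcases huniv i with rfl | rfl | rfl | rfl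
      · simp
      · simp [h1]
      · simp [h2]
      · simp [h3]
    · rintro (rfl | rfl | rfl | rfl)
      · exact ⟨0, by simp⟩
      · exact ⟨1, by simp [h1]⟩
      · exact ⟨2, by simp [h2]⟩
      · exact ⟨3, by simp [h3]⟩

theorem encodes_cycleMask {f : ℕ → V} {n a b c d : ℕ} {j : ι} (hn : n ≤ 5) (ha : a < n)
    (hb : b < n) (hc : c < n) (hd : d < n)
    (hj : D j = {s(f a, f b), s(f b, f c), s(f c, f d), s(f d, f a)}) :
    Encodes D f n j (cycleMask a b c d) := by
  intro e he x hx y hy hxy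
  subst hxy
  rw [hj]
  have := testBit_cycleMask (ha.trans_le hn) (hb.trans_le hn) (hc.trans_le hn) (hd.trans_le hn)
    hy he
  rcases this with ⟨rfl, rfl⟩ | ⟨rfl, rfl⟩ | ⟨rfl, rfl⟩ | ⟨rfl, rfl⟩ | ⟨rfl, rfl⟩ | ⟨rfl, rfl⟩ |
    ⟨rfl, rfl⟩ | ⟨rfl, rfl⟩ <;> simp [*, Sym2.eq_swap]

theorem MinimalDense.six_le_card [Fintype V] {W : Finset V} (hW : MinimalDense D A W)
    (hD : ∀ j ∈ A, IsEvenCycleSet (D j)) (hfree : RainbowEvenFree D A) : 6 ≤ W.card := by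
  by_contra hlt
  have hn : W.card ≤ 5 := by omega
  set R := insideColors D A W with hR
  have hcard : R.card = W.card := hW.card_insideColors hD hfree
  have hRA : ∀ j ∈ R, j ∈ A := fun j hj => (mem_insideColors.1 hj).1
  have hfour : ∀ j ∈ R, _ := fun j hj =>
    (hD j (hRA j hj)).exists_fourCycle (mem_insideColors.1 hj).2 hn
  obtain ⟨j₀, hj₀⟩ : R.Nonempty := Finset.card_pos.1 (hcard ▸ hW.1.card_pos)
  obtain ⟨a, b, c, d, habcd, hWabcd, hE₀⟩ := hfour j₀ hj₀
  -- The vertices of one cycle are numbered first, so that its mask is the fixed one in the finite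
  -- check.
  let L : List V := [a, b, c, d] ++ (W \ [a, b, c, d].toFinset).toList
  have hL : L.Nodup := by
    refine habcd.append (Finset.nodup_toList _) ?_
    intro v hv hv'
    simp only [Finset.mem_toList, Finset.mem_sdiff, List.mem_toFinset] at hv'
    exact hv'.2 hv
  have hLW : ∀ v, v ∈ L ↔ v ∈ W := by
    intro v
    simp only [L, List.mem_append, Finset.mem_toList, Finset.mem_sdiff, List.mem_toFinset]
    have := hWabcd v
    tauto
  have hLlen : L.length = W.card := by
    rw [← List.toFinset_card_of_nodup hL]
    congr 1
    ext v
    simp [hLW]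
  have hge : 4 ≤ W.card := by
    rw [← hLlen]
    simp [L]
  let f : ℕ → V := fun i => L.getD i a
  have hfget : ∀ i (hi : i < L.length), f i = L[i] := fun i hi => List.getD_eq_getElem _ _ hi
  have hf : ∀ x < W.card, ∀ y < W.card, f x = f y → x = y := by
    intro x hx y hy hxy
    rw [hfget x (hLlen ▸ hx), hfget y (hLlen ▸ hy)] at hxy
    exact (hL.getElem_inj_iff).1 hxy
  have hfsurj : ∀ v ∈ W, ∃ i < W.card, f i = v := by
    intro v hv
    obtain ⟨i, hi, hiv⟩ := List.mem_iff_getElem.1 ((hLW v).2 hv)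
    exact ⟨i, hLlen ▸ hi, (hfget i hi).trans hiv⟩
  have hcode₀ : Encodes D f W.card j₀ 174250 :=
    encodes_cycleMask (a := 0) (b := 1) (c := 2) (d := 3) hn (by omega) (by omega) (by omega)
      (by omega) hE₀
  have hcode : ∀ j ∈ R, ∃ w x y z, [w, x, y, z].Nodup ∧
      (w < W.card ∧ x < W.card ∧ y < W.card ∧ z < W.card) ∧
      Encodes D f W.card j (cycleMask w x y z) := by
    intro j hj
    obtain ⟨a', b', c', d', hnd, hmem, hE⟩ := hfour j hj
    obtain ⟨w, hw, rfl⟩ := hfsurj a' (hmem _ (by simp))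
    obtain ⟨x, hx, rfl⟩ := hfsurj b' (hmem _ (by simp))
    obtain ⟨y, hy, rfl⟩ := hfsurj c' (hmem _ (by simp))
    obtain ⟨z, hz, rfl⟩ := hfsurj d' (hmem _ (by simp))
    exact ⟨w, x, y, z, List.Nodup.of_map f (l := [w, x, y, z]) hnd, ⟨hw, hx, hy, hz⟩,
      encodes_cycleMask hn hw hx hy hz hE⟩
  have hl : (R.erase j₀).toList.length = W.card - 1 := by
    rw [Finset.length_toList, Finset.card_erase_of_mem hj₀, hcard]
  have hlnd : (j₀ :: (R.erase j₀).toList).Nodup :=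
    List.nodup_cons.2 ⟨by simp, Finset.nodup_toList _⟩
  have hlR : ∀ q ∈ j₀ :: (R.erase j₀).toList, q ∈ R := by
    intro q hq
    rcases List.mem_cons.1 hq with rfl | hq
    · exact hj₀
    · exact Finset.mem_of_mem_erase (Finset.mem_toList.1 hq)
  generalize (R.erase j₀).toList = l at hl hlnd hlR
  obtain hW4 | hW5 : W.card = 4 ∨ W.card = 5 := by omega
  · rw [hW4] at hl hcode
    obtain ⟨j₁, j₂, j₃, rfl⟩ := List.length_eq_three.1 hl
    have hcode' : ∀ j ∈ R, ∃ m ∈ masksFour, Encodes D f W.card j m := by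
      intro j hj
      obtain ⟨w, x, y, z, hnd, ⟨hw, hx, hy, hz⟩, hm⟩ := hcode j hj
      refine ⟨_, cycleMask_mem_masksFour ⟨w, hw⟩ ⟨x, hx⟩ ⟨y, hy⟩ ⟨z, hz⟩ ?_, by rwa [hW4]⟩
      simpa using hnd
    obtain ⟨m₁, hm₁, h₁⟩ := hcode' j₁ (hlR _ (by simp))
    obtain ⟨m₂, hm₂, h₂⟩ := hcode' j₂ (hlR _ (by simp))
    obtain ⟨m₃, hm₃, h₃⟩ := hcode' j₃ (hlR _ (by simp))
    have key := all_rainbow₄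
    simp only [List.all_eq_true] at key
    exact hfree.not_rainbow₄ hf hlnd (fun q hq => hRA q (hlR q hq)) hcode₀ h₁ h₂ h₃
      (key m₁ hm₁ m₂ hm₂ m₃ hm₃)
  · rw [hW5] at hl hcode
    obtain ⟨j₁, l, rfl⟩ : ∃ j₁ l', l = j₁ :: l' := by
      cases l with
      | nil => simp at hl
      | cons q l => exact ⟨q, l, rfl⟩
    obtain ⟨j₂, j₃, j₄, rfl⟩ := List.length_eq_three.1 (by simpa using hl)
    have hcode' : ∀ j ∈ R, ∃ m ∈ masksFive, Encodes D f W.card j m := by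
      intro j hj
      obtain ⟨w, x, y, z, hnd, ⟨hw, hx, hy, hz⟩, hm⟩ := hcode j hj
      refine ⟨_, cycleMask_mem_masksFive ⟨w, hw⟩ ⟨x, hx⟩ ⟨y, hy⟩ ⟨z, hz⟩ ?_, by rwa [hW5]⟩
      simpa using hnd
    obtain ⟨m₁, hm₁, h₁⟩ := hcode' j₁ (hlR _ (by simp))
    obtain ⟨m₂, hm₂, h₂⟩ := hcode' j₂ (hlR _ (by simp))
    obtain ⟨m₃, hm₃, h₃⟩ := hcode' j₃ (hlR _ (by simp))
    obtain ⟨m₄, hm₄, h₄⟩ := hcode' j₄ (hlR _ (by simp))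
    have key := all_rainbow₅
    simp only [List.all_eq_true, Bool.or_eq_true] at key
    have h5 := hfree.not_rainbow₅ hf hlnd (fun q hq => hRA q (hlR q hq)) hcode₀ h₁ h₂ h₃ h₄
    rcases key m₁ hm₁ m₂ hm₂ m₃ hm₃ with h | h
    · exact h5 (by simp [rainbow₅, h])
    · exact h5 (h m₄ hm₄)

end SmallSets

/-! ### Contraction and counting -/

section Main

open Classical

variable {V X ι : Type*} {D : ι → Set (Sym2 V)}

/-- Modulo `φ` the edges of `T` become trivial, so a link in `V` by `T ∪ I` projects to a link by
`I` alone. -/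
theorem Indep.union_of_fibers {φ : V → X} {g : ι → Sym2 V} {T I : Finset ι} (hT : Indep id T g)
    (hI : Indep φ I g) (hTI : Disjoint T I) (hφ : ∀ a b, s(a, b) ∈ g '' ↑T → φ a = φ b) :
    Indep id (T ∪ I) g := by
  induction I using Finset.induction_on with
  | empty => simpa using hT
  | insert i I hi ih =>
    obtain ⟨hiT, hTI⟩ := Finset.disjoint_insert_right.1 hTI
    have ih := ih (hI.mono (Finset.subset_insert i I)) hTI
    obtain ⟨a, b, hab⟩ : ∃ a b, g i = s(a, b) := by
      induction g i with | _ a b => exact ⟨a, b, rfl⟩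
    rw [Finset.union_insert]
    refine ih.insert (by simp [hiT, hi]) hab fun hl => ?_
    refine hI i (Finset.mem_insert_self _ _) a b hab ?_
    rw [Finset.erase_insert hi]
    refine (Linked.map (φ := φ) hl).of_forall fun p q hpq => ?_
    rw [Finset.coe_union, Set.image_union] at hpq
    rcases hpq with hpq | hpq
    · rw [hφ p q hpq]
      exact Linked.refl _
    · exact Linked.of_mem hpq

theorem iff_transfer {u v x y : Prop} (h : u ↔ v) : (x ↔ y) ↔ ((u ↔ x) ↔ (v ↔ y)) := by
  tauto

/-- The map `φ` followed by the identification of all points of `φ '' W` with `φ w`. -/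
noncomputable def collapseImage (φ : V → X) (W : Finset V) (w : V) (v : V) : X :=
  if φ v ∈ W.image φ then φ w else φ v

theorem collapseImage_of_mem {φ : V → X} {W : Finset V} {w v : V} (hv : v ∈ W) :
    collapseImage φ W w v = φ w := if_pos (Finset.mem_image_of_mem φ hv)

theorem collapseImage_eq_cases {φ : V → X} {W : Finset V} {w u v : V} (hw : w ∈ W)
    (h : collapseImage φ W w u = collapseImage φ W w v) :
    φ u = φ v ∨ (φ u ∈ W.image φ ∧ φ v ∈ W.image φ) := by
  have hw' := Finset.mem_image_of_mem φ hw
  unfold collapseImage at h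
  split_ifs at h with h1 h2 h2
  · exact Or.inr ⟨h1, h2⟩
  · exact absurd (h ▸ hw') h2
  · exact absurd (h ▸ hw') h1
  · exact Or.inl h

/-- `φ`-cycles that do not close up in `V` cannot be rainbow: if an edge of an unused color joins
two vertices linked modulo `φ` by a choice of edges, these are linked in `V`. -/
def Closing (φ : V → X) (D : ι → Set (Sym2 V)) (A : Finset ι) : Prop :=
  ∀ S g, Choice D A S g → ∀ j ∈ A, j ∉ S → ∀ u v, s(u, v) ∈ D j → φ u ≠ φ v →
    Linked φ (g '' ↑S) (φ u) (φ v) → Linked id (g '' ↑S) u v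

/-- A rainbow cycle that closes only after the contraction must pass through two distinct points
`x`, `y` of `W`. Any rainbow spanning tree of `W` completes it to a cycle in `V`, necessarily odd;
but switching the tree changes the parity between `x` and `y` and nothing else. -/
theorem Closing.collapse [Fintype V] {φ : V → X} {A : Finset ι} {W : Finset V} {w : V}
    (hφ : Closing φ D A) (hW : MinimalDense D A W) (hw : w ∈ W)
    (hD : ∀ j ∈ A, IsEvenCycleSet (D j)) (hfree : RainbowEvenFree D A) :
    Closing (collapseImage φ W w) D (A \ insideColors D A W) := by
  intro S g hS j hj hjS u v huv hne hl
  obtain ⟨hjA, hjR⟩ := Finset.mem_sdiff.1 hj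
  set R := insideColors D A W with hRdef
  set φ' := collapseImage φ W w with hφ'
  have hRA : R ⊆ A := fun k hk => (mem_insideColors.1 hk).1
  by_contra hnl
  obtain ⟨I, hIS, hIl, hI, -⟩ := exists_minimal_linking hl
  have hnl : ¬ Linked id (g '' ↑I) u v := fun h =>
    hnl (h.mono (Set.image_mono (Finset.coe_subset.2 hIS)))
  have hne' : φ u ≠ φ v := fun h => hne (by simp [hφ', collapseImage, h])
  have key : ∀ T h, IsSpanning D R W T h → ∃ k : ι → Sym2 V, k '' ↑(T ∪ I) = h '' ↑T ∪ g '' ↑I ∧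
      Choice D A (T ∪ I) k ∧ Indep id (T ∪ I) k ∧ Linked id (k '' ↑(T ∪ I)) u v := by
    intro T h hT
    have hTI : Disjoint T I := Finset.disjoint_left.2 fun i hi hi' =>
      (Finset.mem_sdiff.1 (hS.1 (hIS hi'))).2 (hT.1.1 hi)
    let k : ι → Sym2 V := fun i => if i ∈ T then h i else g i
    have hkT : ∀ i ∈ T, h i = k i := fun i hi => (if_pos hi).symm
    have hkI : ∀ i ∈ I, g i = k i := fun i hi => (if_neg (Finset.disjoint_right.1 hTI hi)).symm
    have himT : k '' ↑T = h '' ↑T := Set.image_congr fun i hi => (hkT i hi).symm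
    have himI : k '' ↑I = g '' ↑I := Set.image_congr fun i hi => (hkI i hi).symm
    have him : k '' ↑(T ∪ I) = h '' ↑T ∪ g '' ↑I := by
      rw [Finset.coe_union, Set.image_union, himT, himI]
    have hC : Choice D A (T ∪ I) k := by
      refine ⟨Finset.union_subset (hT.1.1.trans hRA)
        (hIS.trans (hS.1.trans Finset.sdiff_subset)), fun i hi => ?_⟩
      rcases Finset.mem_union.1 hi with hi | hi
      · rw [← hkT i hi]
        exact hT.1.2 i hi
      · rw [← hkI i hi]
        exact hS.2 i (hIS hi)
    refine ⟨k, him, hC, ?_, hφ _ _ hC j hjA ?_ u v huv hne' ?_⟩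
    · refine (hT.2.1.congr hkT).union_of_fibers (hI.congr hkI) hTI fun a b hab => ?_
      rw [himT] at hab
      rw [hφ', collapseImage_of_mem (hT.1.mem_of_inside subset_rfl _ hab a (Sym2.mem_mk_left a b)),
        collapseImage_of_mem (hT.1.mem_of_inside subset_rfl _ hab b (Sym2.mem_mk_right a b))]
    · rw [Finset.mem_union, not_or]
      exact ⟨fun h => hjR (hT.1.1 h), fun h => hjS (hIS h)⟩
    · intro c hc
      -- The tree links all points of `φ '' W`, so adding it to `I` has the effect of the collapse.
      have hcφ : ∀ z, c (φ z) ↔ c (φ' z) := by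
        intro z
        by_cases hz : φ z ∈ W.image φ
        · have : φ' z = φ w := if_pos hz
          rw [this]
          obtain ⟨z', hz', hzz'⟩ := Finset.mem_image.1 hz
          rw [← hzz']
          refine (Linked.map (φ := φ) (hT.2.2 z' hz' w hw)) c fun a b hab => hc a b ?_
          rw [him]
          exact Or.inl hab
        · have : φ' z = φ z := if_neg hz
          rw [this]
      rw [hcφ u, hcφ v]
      refine hIl c fun a b hab => ?_
      rw [← hcφ a, ← hcφ b]
      refine hc a b ?_
      rw [him]
      exact Or.inr hab
  have key' : ∀ T h, IsSpanning D R W T h → ∃ η, Bicolors η (h '' ↑T ∪ g '' ↑I) ∧ (η u ↔ η v) := by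
    intro T h hT
    obtain ⟨k, him, hC, hk, hkl⟩ := key T h hT
    obtain ⟨η, hη⟩ := hk.exists_bicolors
    refine ⟨η, him ▸ hη, hfree.congr_of_linked hC hjA ?_ huv ?_ hkl hη⟩
    · rw [Finset.mem_union, not_or]
      exact ⟨fun h => hjR (hT.1.1 h), fun h => hjS (hIS h)⟩
    · rw [him]
      rintro (hmem | hmem)
      · refine hne ?_
        rw [hφ', collapseImage_of_mem (hT.1.mem_of_inside subset_rfl _ hmem u (Sym2.mem_mk_left u v)),
          collapseImage_of_mem (hT.1.mem_of_inside subset_rfl _ hmem v (Sym2.mem_mk_right u v))]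
      · exact hnl (Linked.of_mem (φ := id) hmem)
  obtain ⟨T, h, hT⟩ := hW.exists_isSpanning hD subset_rfl hW.2.1
  -- Leaving the `I`-component of `p` requires a tree edge, and tree edges lie in `W`.
  have hreach : ∀ p q, Linked id (h '' ↑T ∪ g '' ↑I) p q → ¬ Linked id (g '' ↑I) p q →
      ∃ x ∈ W, Linked id (g '' ↑I) p x := by
    intro p q hpq hpq'
    by_contra! hcon
    refine hpq' ((hpq (fun z => Linked id (g '' ↑I) p z) fun a b hab => ?_).1 (Linked.refl p))
    rcases hab with hab | hab
    · have ha := hcon a (hT.1.mem_of_inside subset_rfl _ hab a (Sym2.mem_mk_left a b))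
      have hb := hcon b (hT.1.mem_of_inside subset_rfl _ hab b (Sym2.mem_mk_right a b))
      exact ⟨fun h => absurd h ha, fun h => absurd h hb⟩
    · have := Linked.of_mem (φ := id) hab
      exact ⟨fun h => h.trans this, fun h => h.trans this.symm⟩
  obtain ⟨k, him, -, -, hkl⟩ := key T h hT
  rw [him] at hkl
  obtain ⟨x, hx, hux⟩ := hreach u v hkl hnl
  obtain ⟨y, hy, hvy⟩ := hreach v u hkl.symm fun h => hnl h.symm
  have hxy : x ≠ y := by
    rintro rfl
    exact hnl (hux.trans hvy.symm)
  obtain ⟨η, hη, hηuv⟩ := key' T h hT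
  obtain ⟨T', h', χ', hT', hχ', hpar, -⟩ := hW.exists_isSpanning_switch hD (hfree.mono hRA)
    subset_rfl hW.2.1 hT (hη.mono Set.subset_union_left) hx hy hxy
  obtain ⟨η', hη', hηuv'⟩ := key' T' h' hT'
  have h1 := (hη.mono Set.subset_union_right).congr_iff (hη'.mono Set.subset_union_right) hux
  have h2 := (hη.mono Set.subset_union_right).congr_iff (hη'.mono Set.subset_union_right) hvy
  have h3 := (hη'.mono Set.subset_union_left).congr_iff hχ' (hT'.2.2 x hx y hy)
  have h4 := iff_transfer (x := η x) (y := η y) hηuv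
  have h5 := iff_transfer (x := η' x) (y := η' y) hηuv'
  rw [h1, h2, ← h5, h3, hpar] at h4
  exact iff_not_self h4

/-- Collapsing a minimal dense set keeps the remaining cycles nonconstant. -/
theorem MinimalDense.exists_collapse_ne [Fintype V] {φ : V → X} {A : Finset ι} {W : Finset V}
    {w : V} (hφ : Closing φ D A) (hW : MinimalDense D A W) (hw : w ∈ W)
    (hD : ∀ j ∈ A, IsEvenCycleSet (D j)) (hinj : Set.InjOn φ W) {j : ι} (hjA : j ∈ A)
    (hjR : j ∉ insideColors D A W) (hne : ∃ u v, s(u, v) ∈ D j ∧ φ u ≠ φ v) :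
    ∃ u v, s(u, v) ∈ D j ∧ collapseImage φ W w u ≠ collapseImage φ W w v := by
  by_contra! hcon
  obtain ⟨S, g, hS⟩ := hW.exists_isSpanning hD subset_rfl hW.2.1
  have hin := hS.1.mem_of_inside subset_rfl
  obtain ⟨u₀, v₀, huv₀, hne₀⟩ := hne
  -- An edge made constant only by the collapse joins points that the tree links modulo `φ`, hence
  -- links in `V`; so its ends lie in `W`.
  have hcover : ∀ u v, s(u, v) ∈ D j → φ u = φ v ∨ (u ∈ (W : Set V) ∧ v ∈ (W : Set V)) := by
    intro u v huv
    by_cases hφuv : φ u = φ v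
    · exact Or.inl hφuv
    right
    obtain ⟨hu, hv⟩ := (collapseImage_eq_cases hw (hcon u v huv)).resolve_left hφuv
    obtain ⟨u', hu', huu'⟩ := Finset.mem_image.1 hu
    obtain ⟨v', hv', hvv'⟩ := Finset.mem_image.1 hv
    have hl : Linked id (g '' ↑S) u v := by
      refine hφ S g ⟨hS.1.1.trans fun k hk => (mem_insideColors.1 hk).1, hS.1.2⟩ j hjA
        (fun h => hjR (hS.1.1 h)) u v huv hφuv ?_
      rw [← huu', ← hvv']
      exact (hS.2.2 u' hu' v' hv').map
    have huW : u ∈ (W : Set V) := by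
      by_contra huW
      have h1 : v = u := (hl (fun z => z = u) fun a b hab => by
        have ha : a ≠ u := fun h => huW (h ▸ hin _ hab a (Sym2.mem_mk_left a b))
        have hb : b ≠ u := fun h => huW (h ▸ hin _ hab b (Sym2.mem_mk_right a b))
        exact ⟨fun h => absurd h ha, fun h => absurd h hb⟩).1 rfl
      exact hφuv (h1 ▸ rfl)
    exact ⟨huW, hl.mem_of_mem hin huW⟩
  have hsub := (hD j hjA).subset_of_fibers hinj hcover huv₀ hne₀
  refine hjR (mem_insideColors.2 ⟨hjA, fun e he z hz => ?_⟩)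
  induction e with | _ a b =>
  rcases Sym2.mem_iff.1 hz with rfl | rfl
  · exact (hsub _ _ he).1
  · exact (hsub _ _ he).2

/-- The bound for even cycles without rainbow even cycle, modulo a map to `Q`. -/
theorem RainbowEvenFree.card_le [Fintype V] (φ : V → X) (Q : Finset X) (A : Finset ι)
    (hQ : Q.Nonempty) (hφQ : ∀ v, φ v ∈ Q) (hD : ∀ j ∈ A, IsEvenCycleSet (D j))
    (hne : ∀ j ∈ A, ∃ u v, s(u, v) ∈ D j ∧ φ u ≠ φ v) (hfree : RainbowEvenFree D A)
    (hφ : Closing φ D A) : 5 * A.card + 6 ≤ 6 * Q.card := by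
  induction hn : Q.card using Nat.strong_induction_on generalizing φ Q A with
  | _ n ih =>
  subst hn
  have hQpos := hQ.card_pos
  by_cases hlt : A.card < Q.card
  · omega
  obtain ⟨S, g, W₀, -, hI, hW₀, hcard, hl⟩ :=
    exists_dense_set hQ (fun _ _ _ _ v _ => hφQ v) (not_lt.1 hlt) hD hne hφ
  obtain ⟨W, hWW₀, hW⟩ := exists_minimalDense hW₀ hcard
  -- `W` is linked in `V` by a forest modulo `φ`; two of its points with the same image would close
  -- a cycle there.
  have hinj : Set.InjOn φ W := by
    intro x hx y hy hxy
    by_contra hne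
    obtain ⟨I, hIS, hIl, -, hsplit⟩ := exists_minimal_linking (hl x (hWW₀ hx) y (hWW₀ hy))
    obtain ⟨i, hi⟩ : I.Nonempty := by
      rw [Finset.nonempty_iff_ne_empty]
      rintro rfl
      exact hne (hIl.eq_of_forall (c := id) (by simp))
    obtain ⟨a, b, hab⟩ : ∃ a b, g i = s(a, b) := by
      induction g i with | _ a b => exact ⟨a, b, rfl⟩
    have hsub : g '' ↑(I.erase i) ⊆ g '' ↑(S.erase i) :=
      Set.image_mono (Finset.coe_subset.2 (Finset.erase_subset_erase i hIS))
    rcases hsplit i hi a b hab with ⟨h1, h2⟩ | ⟨h1, h2⟩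
    · have h1' := Linked.map (φ := φ) (h1.mono hsub)
      have h2' := Linked.map (φ := φ) (h2.mono hsub)
      rw [hxy] at h1'
      exact hI i (hIS hi) a b hab (h1'.symm.trans h2')
    · have h1' := Linked.map (φ := φ) (h1.mono hsub)
      have h2' := Linked.map (φ := φ) (h2.mono hsub)
      rw [hxy] at h1'
      exact hI i (hIS hi) a b hab (h2'.symm.trans h1')
  obtain ⟨w, hw⟩ := hW.1
  have hcardR := hW.card_insideColors hD hfree
  have hsix := hW.six_le_card hD hfree
  have hRA : insideColors D A W ⊆ A := fun k hk => (mem_insideColors.1 hk).1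
  have himQ : W.image φ ⊆ Q := Finset.image_subset_iff.2 fun v _ => hφQ v
  have himcard : (W.image φ).card = W.card := Finset.card_image_of_injOn hinj
  have hQ'card : (insert (φ w) (Q \ W.image φ)).card = Q.card - W.card + 1 := by
    rw [Finset.card_insert_of_notMem, Finset.card_sdiff_of_subset himQ, himcard]
    simp only [Finset.mem_sdiff, not_and, not_not]
    exact fun _ => Finset.mem_image_of_mem φ hw
  have hWQ : W.card ≤ Q.card := himcard ▸ Finset.card_le_card himQ
  have hA' : (A \ insideColors D A W).card = A.card - W.card := by
    rw [Finset.card_sdiff_of_subset hRA, hcardR]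
  have := ih _ (by omega) (collapseImage φ W w) (insert (φ w) (Q \ W.image φ))
    (A \ insideColors D A W) (Finset.insert_nonempty _ _)
    (fun v => by
      unfold collapseImage
      split_ifs with h
      · exact Finset.mem_insert_self _ _
      · exact Finset.mem_insert_of_mem (Finset.mem_sdiff.2 ⟨hφQ v, h⟩))
    (fun j hj => hD j (Finset.mem_sdiff.1 hj).1)
    (fun j hj => hW.exists_collapse_ne hφ hw hD hinj (Finset.mem_sdiff.1 hj).1
      (Finset.mem_sdiff.1 hj).2 (hne j (Finset.mem_sdiff.1 hj).1))
    (hfree.mono Finset.sdiff_subset) (hφ.collapse hW hw hD hfree) hQ'card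
  -- With `w = |W|`, induction gives `5(|A| - w) + 6 ≤ 6(|Q| - w + 1)`; this suffices exactly
  -- because `w ≥ 6`.
  omega

end Main

/-! ### Translation to colored graphs -/

section ColoredGraphs

open Classical

variable {V C : Type*}

theorem ColoredGraph.IsEvenCycle.isEvenCycleSet {G : ColoredGraph V C} (hG : G.IsEvenCycle) :
    IsEvenCycleSet G.edgeSet := by
  obtain ⟨l, hl, u, p, hp, rfl, hedges⟩ := hG
  obtain ⟨k, hk⟩ := hl.two_dvd
  have h3 := hp.three_le_length
  have : NeZero (2 * k) := ⟨by omega⟩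
  have : Fact (1 < 2 * k) := ⟨by omega⟩
  have hval : ∀ i : ZMod (2 * k), p.getVert (i + 1).val = p.getVert (i.val + 1) := by
    intro i
    have hi := i.val_lt
    rw [ZMod.val_add, ZMod.val_one]
    rcases (Nat.succ_le_of_lt hi).lt_or_eq with h | h
    · rw [Nat.mod_eq_of_lt h]
    · have h' : i.val + 1 = 2 * k := h
      rw [h', Nat.mod_self, ← hk, p.getVert_length, p.getVert_zero]
  refine ⟨k, by omega, fun i => p.getVert i.val, ?_, ?_⟩
  · intro i j hij
    have hi := i.val_lt
    have hj := j.val_lt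
    exact ZMod.val_injective _ (hp.getVert_injOn' (by simp only [Set.mem_ofPred_eq]; omega)
      (by simp only [Set.mem_ofPred_eq]; omega) hij)
  · ext e
    rw [← hedges]
    simp only [Set.mem_range, hval]
    constructor
    · intro he
      obtain ⟨n, hn, rfl⟩ := List.mem_iff_getElem.1 he
      rw [SimpleGraph.Walk.length_edges] at hn
      refine ⟨(n : ZMod (2 * k)), ?_⟩
      rw [ZMod.val_natCast_of_lt (by omega), SimpleGraph.Walk.getElem_edges]
    · rintro ⟨i, rfl⟩
      have hi := i.val_lt
      exact (p.mk_mem_edges_iff_exists).2 ⟨i.val, by omega, rfl⟩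

/-- An even rainbow cycle among partial transversals of the edge sets is an even rainbow cycle
contained in the family. -/
theorem exists_isRainbow_of_choice {m : ℕ} {D : Fin m → ColoredGraph V C}
    (hD : ColoredGraph.IsFamily D) {A S : Finset (Fin m)} {g : Fin m → Sym2 V}
    (hS : Choice (fun i => (D i).edgeSet) A S g) {x : V}
    (p : (SimpleGraph.fromEdgeSet (g '' ↑S)).Walk x x) (hp : p.IsCycle) (heven : Even p.length) :
    ∃ R : ColoredGraph V C,
      R.IsEvenCycle ∧ R.IsRainbow ∧ ColoredGraph.FamilyContains D R := by
  obtain ⟨α, hα, hcol⟩ := hD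
  have hmem : ∀ e ∈ p.edges, ∃ i ∈ S, g i = e := by
    intro e he
    have := p.edges_subset_edgeSet he
    rw [SimpleGraph.edgeSet_fromEdgeSet] at this
    exact this.1
  have : Nonempty (Fin m) := by
    have h3 := hp.three_le_length
    rw [← p.length_edges] at h3
    exact ⟨(hmem _ (List.getElem_mem (show 0 < p.edges.length by omega))).choose⟩
  choose! σ hσS hσ using hmem
  -- Every edge gets the color of one index that chose it. Distinct edges have distinct indices
  -- since `g (σ e) = e`.
  let R : ColoredGraph V C :=
    { edges := {e | e.1 ∈ p.edges ∧ e.2 = α (σ e.1)}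
      not_isDiag := fun e he =>
        (SimpleGraph.fromEdgeSet (g '' ↑S)).not_isDiag_of_mem_edgeSet (p.edges_subset_edgeSet he.1)
      simple := fun e he f hf hef => Prod.ext hef (by rw [he.2, hf.2, hef]) }
  have hRedge : ∀ e, e ∈ R.edgeSet ↔ e ∈ p.edges := by
    intro e
    constructor
    · rintro ⟨f, hf, rfl⟩
      exact hf.1
    · intro he
      exact ⟨(e, α (σ e)), ⟨he, rfl⟩, rfl⟩
  have hadj : ∀ e ∈ p.edges, e ∈ R.toSimpleGraph.edgeSet := by
    intro e he
    rw [ColoredGraph.toSimpleGraph, SimpleGraph.edgeSet_fromEdgeSet]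
    exact ⟨(hRedge e).2 he,
      (SimpleGraph.fromEdgeSet (g '' ↑S)).not_isDiag_of_mem_edgeSet (p.edges_subset_edgeSet he)⟩
  refine ⟨R, ⟨p.length, heven, x, p.transfer _ hadj, hp.transfer hadj, p.length_transfer hadj,
    fun e => ?_⟩, ?_, ?_⟩
  · rw [p.edges_transfer hadj, hRedge]
  · intro e he f hf hef
    have h1 : α (σ e.1) = α (σ f.1) := by rw [← he.2, ← hf.2, hef]
    refine Prod.ext ?_ hef
    rw [← hσ e.1 he.1, ← hσ f.1 hf.1, hα h1]
  · rintro ⟨e, c⟩ ⟨he, hc⟩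
    dsimp only at he hc
    refine Set.mem_iUnion.2 ⟨σ e, ?_⟩
    have h1 := hS.2 (σ e) (hσS e he)
    rw [hσ e he] at h1
    obtain ⟨⟨e', c'⟩, h2, h3⟩ := h1
    dsimp only at h3
    subst h3
    have h4 : c' ∈ (D (σ e')).colors := ⟨_, h2, rfl⟩
    rw [hcol] at h4
    have h5 : c' = c := (Set.mem_singleton_iff.1 h4).trans hc.symm
    exact h5 ▸ h2

end ColoredGraphs

theorem theorem1p2 {V C : Type*} [Fintype V] (n m : ℕ) (hV : Fintype.card V = n)
    (hm : (m : ℤ) = ⌊6 * ((n : ℚ) - 1) / 5⌋ + 1)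
    (D : Fin m → ColoredGraph V C) (hD : ColoredGraph.IsFamily D)
    (hcycle : ∀ i, (D i).IsEvenCycle) :
    ∃ R : ColoredGraph V C,
      R.IsEvenCycle ∧ R.IsRainbow ∧ ColoredGraph.FamilyContains D R := by
  by_contra hcon
  have hcyc : ∀ i, IsEvenCycleSet (D i).edgeSet := fun i => (hcycle i).isEvenCycleSet
  have hfloor : (6 * ((n : ℚ) - 1) / 5) < m := by
    have := Int.lt_floor_add_one (6 * ((n : ℚ) - 1) / 5)
    have h' : (m : ℚ) = (⌊6 * ((n : ℚ) - 1) / 5⌋ : ℚ) + 1 := by exact_mod_cast hm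
    rwa [h']
  have hlt : 6 * n < 5 * m + 6 := by
    have : (6 * n : ℚ) < 5 * m + 6 := by linarith
    exact_mod_cast this
  have hne : (Finset.univ : Finset V).Nonempty := by
    rw [← Finset.card_pos, Finset.card_univ, hV]
    by_contra hn
    obtain rfl : n = 0 := by omega
    -- For `n = 0` the formula would give `m = -1`.
    have : ⌊6 * (((0 : ℕ) : ℚ) - 1) / 5⌋ = -2 := by
      rw [Int.floor_eq_iff]
      norm_num
    omega
  have := RainbowEvenFree.card_le (D := fun i => (D i).edgeSet) id Finset.univ Finset.univ hne
    (fun v => Finset.mem_univ v) (fun i _ => hcyc i)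
    (fun i _ => by
      obtain ⟨u, v, huv⟩ := (hcyc i).nonempty
      exact ⟨u, v, huv, (hcyc i).not_isDiag huv⟩)
    (fun S g hS x p hp heven => hcon (exists_isRainbow_of_choice hD hS p hp heven))
    (fun S g _ j _ _ u v _ _ h => h)
  rw [Finset.card_univ, Finset.card_univ, Fintype.card_fin, hV] at this
  omega
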